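/- **Base category.** Write $n$ for $\{1,\dots,n\}$. Let $\mathbb C$ be the free category on the graph with vertices $\star$, $[n]$, $\pi^l_n$, $\pi^r_n$, $\pi_n$, $\nu_n$, $\heartsuit_n$, $\tau_n$, $\iota_{n,a}$, $o_{n,a,b}$, $\tau_{n,a,m,c,d}$ ($n,m\in\mathbb N$; $a,b\in n$; $c,d\in m$) and edges $s_1,\dots,s_n\colon\star\to[n]$; $t\colon[n]\to v$ and $s\colon[n']\to v$ for each $v\in\{\pi^l_n,\pi^r_n,\heartsuit_n,\tau_n,o_{n,a,b},\nu_n,\iota_{n,a}\}$, where $n'=n+1$ if $v$ is $\nu_n$ or $\iota_{n,a}$ and $n'=n$ otherwise; $\pi^l_n\xrightarrow{l}\pi_n\xleftarrow{r}\pi^r_n$; and $\iota_{n,a}\xrightarrow{\rho}\tau_{n,a,m,c,d}\xleftarrow{\epsilon}o_{m,c,d}$; modulo the equations $s\circ s_i=t\circ s_i$ ($i\in n$), $l\circ t=r\circ t$, $\rho\circ t\circ s_a=\epsilon\circ t\circ s_c$ and $\rho\circ s\circ s_{n+1}=\epsilon\circ s\circ s_d$. The dimension of $\star$ is $0$, of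 $[n]$ is $1$, of the vertices $v$ above is $2$, of $\pi_n$ is $3$, of $\tau_{n,a,m,c,d}$ is $4$. Objects of $\mathbb C$ are identified with representable presheaves in $\widehat{\mathbb C}$. **Positions.** A *position* is a presheaf on $\mathbb C$ with finitely many elements, all of dimension at most $1$. A map of presheaves is *1-injective* if it is injective in all positive dimensions. $\mathbb D_h$ is the category of positions and 1-injective maps. **Traces.** Write $[m]\,{}_{a_1,\dots,a_p}|_{c_1,\dots,c_p}[n]$ for the position made of an $m$-ary agent $x$ and an $n$-ary agent $y$ quotiented by $x\cdot s_{a_k}=y\cdot s_{c_k}$ for all $k\leq p$. The *seeds* are the cospans $Y\xrightarrow{s}M\xleftarrow{t}X$ (with $X$ initial and $Y$ final): $[n']\xrightarrow{s}v\xleftarrow{t}[n]$ for each $v$ of dimension $2$; $[n]\,{}_{1,\dots,n}|_{1,\dots,n}[n]\xrightarrow{[ls,rs]}\pi_n\xleftarrow{lt}[n]$; and $[m]\,{}_{c,d}|_{a,n+1}[n+1]\xrightarrow{[\epsilon s,\rho s]}\tau_{n,a,m,c,d}\xleftarrow{[\epsilon t,\rho t]}[m]\,{}_{c}|_{a}[n]$.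 The interface $I_X$ of a seed is the coproduct of $X(\star)$ copies of $\star$; its canonical map to $M$ through $X$ also factors uniquely through $Y$. An *action* is a cospan obtained from a seed $Y\to M\leftarrow X$ by pushing $Y$, $M$ and $X$ out along a map $I_X\to Z$ to some position $Z$. A *trace* $Y\to U\leftarrow X$ is a cospan isomorphic to a finite, possibly empty composite (by pushout) of actions; its codomain is its initial position $X$. $\mathbb D_H$ is the category whose objects are the traces and whose morphisms are the commuting diagrams (double cells) $$\begin{array}{ccccc}Y&\to&U&\leftarrow&X\\ \downarrow&&\downarrow&&\downarrow\\ Y'&\to&U'&\leftarrow&X'\end{array}$$ with 1-injective vertical components. **The larger categories.** Let $\mathcal V_0$ be the set of lower legs $t$ of seeds, $\mathcal H=\mathcal V_0^{\perp}$ the class of maps of $\widehat{\mathbb C}$ that are right-orthogonal (with unique fillers) to all of $\mathcal V_0$, and $\mathcal V={}^{\perp}\mathcal H$. $\mathbb D^1_h$ is the category of positions and all natural transformations; $\mathbb D^1_H$ is the category of cospans $Y\xrightarrow{s}U\xleftarrow{t}X$ in $\widehat{\mathbb C}$ between positions with $t\in\mathcal V$, and all double cells. Then $\mathbb D_H\subseteq\mathbb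 D^1_H$ and $\mathbb D_h\subseteq\mathbb D^1_h$. For a functor $p\colon E\to B$, a morphism $r\colon e'\to e$ of $E$ is *cartesian* if for all $t\colon e''\to e$ and $k\colon p(e'')\to p(e')$ with $p(r)\circ k=p(t)$ there is a unique $q\colon e''\to e'$ with $p(q)=k$ and $r\circ q=t$; and $p$ is a *fibration* if for every object $e$ of $E$ every $h\colon b\to p(e)$ has a cartesian lifting, i.e. is the image of some cartesian $r\colon e'\to e$. **Lemma.** The codomain functor $\mathrm{cod}\colon\mathbb D_H\to\mathbb D_h$ is a subfibration of $\mathrm{cod}\colon\mathbb D^1_H\to\mathbb D^1_h$: it is the restriction of the latter to the subcategories $\mathbb D_H$ and $\mathbb D_h$, it is a fibration, and every morphism of $\mathbb D_H$ that is cartesian for it is cartesian for $\mathrm{cod}\colon\mathbb D^1_H\to\mathbb D^1_h$. Moreover, for every trace $U$ with initial position $X$ and every morphism of positions $h\colon X'\to X$ in $\mathbb D_h$, there is a morphism of $\mathbb D_H$ into $U$ over $h$ that is cartesian both for $\mathbb D_H\to\mathbb D_h$ and for $\mathbb D^1_H\to\mathbb D^1_h$; and every $\mathbb D^1$-cartesian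 lifting of $h$ at $U$ has a trace as its domain, has 1-injective components, and is cartesian in $\mathbb D_H$. -/

import Mathlib

open CategoryTheory CategoryTheory.Limits Opposite

noncomputable section

namespace PiTraces

/-! ### The base category -/

/-- The shapes of dimension `2`: left half-fork, right half-fork, tick, silent action,
output (of the `b`th channel on the `a`th one), channel creation, and input (on the `a`th
channel). They are indexed by the arities of the agent before and after the action. The elements
`1, …, n` are represented by `Fin n`. -/
inductive Basic : ℕ → ℕ → Type
  | forkLeft (n : ℕ) : Basic n n
  | forkRight (n : ℕ) : Basic n n
  | tick (n : ℕ) : Basic n n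
  | silent (n : ℕ) : Basic n n
  | out (n : ℕ) (a b : Fin n) : Basic n n
  | new (n : ℕ) : Basic n (n + 1)
  | inp (n : ℕ) (a : Fin n) : Basic n (n + 1)

/-- The `i`th channel known before the action is the `i`th one known after it. -/
def Basic.keep {n n' : ℕ} (v : Basic n n') : Fin n → Fin n' :=
  Fin.castLE (by cases v <;> simp)

/-- Vertices of the generating graph; `agent n` is `[n]`, `fork n` is `π_n`, and
`sync n a m c d` is `τ_{n,a,m,c,d}`. -/
inductive Vertex : Type
  | star
  | agent (n : ℕ)
  | basic {n n' : ℕ} (v : Basic n n')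
  | fork (n : ℕ)
  | sync (n : ℕ) (a : Fin n) (m : ℕ) (c d : Fin m)

/-- Edges of the generating graph. -/
inductive Edge : Vertex → Vertex → Type
  | chan (n : ℕ) (i : Fin n) : Edge .star (.agent n)
  | t {n n' : ℕ} (v : Basic n n') : Edge (.agent n) (.basic v)
  | s {n n' : ℕ} (v : Basic n n') : Edge (.agent n') (.basic v)
  | l (n : ℕ) : Edge (.basic (.forkLeft n)) (.fork n)
  | r (n : ℕ) : Edge (.basic (.forkRight n)) (.fork n)
  | rho (n : ℕ) (a : Fin n) (m : ℕ) (c d : Fin m) : Edge (.basic (.inp n a)) (.sync n a m c d)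
  | eps (n : ℕ) (a : Fin n) (m : ℕ) (c d : Fin m) : Edge (.basic (.out m c d)) (.sync n a m c d)

instance : Quiver Vertex := ⟨Edge⟩

/-- An edge as a morphism of the free category. -/
def Edge.path {x y : Vertex} (e : Edge x y) : (Paths.of Vertex).obj x ⟶ (Paths.of Vertex).obj y :=
  (Paths.of Vertex).map e

/-- The equations `s ∘ sᵢ = t ∘ sᵢ`, `l ∘ t = r ∘ t`, `ρ ∘ t ∘ s_a = ε ∘ t ∘ s_c` and
`ρ ∘ s ∘ s_{n+1} = ε ∘ s ∘ s_d`. -/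
inductive Rel : HomRel (Paths Vertex)
  | keep {n n' : ℕ} (v : Basic n n') (i : Fin n) :
      Rel ((Edge.chan n' (v.keep i)).path ≫ (Edge.s v).path)
        ((Edge.chan n i).path ≫ (Edge.t v).path)
  | fork (n : ℕ) :
      Rel ((Edge.t (.forkLeft n)).path ≫ (Edge.l n).path)
        ((Edge.t (.forkRight n)).path ≫ (Edge.r n).path)
  | subject (n : ℕ) (a : Fin n) (m : ℕ) (c d : Fin m) :
      Rel ((Edge.chan n a).path ≫ (Edge.t (.inp n a)).path ≫ (Edge.rho n a m c d).path)
        ((Edge.chan m c).path ≫ (Edge.t (.out m c d)).path ≫ (Edge.eps n a m c d).path)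
  | object (n : ℕ) (a : Fin n) (m : ℕ) (c d : Fin m) :
      Rel ((Edge.chan (n + 1) (Fin.last n)).path ≫ (Edge.s (.inp n a)).path ≫
          (Edge.rho n a m c d).path)
        ((Edge.chan m d).path ≫ (Edge.s (.out m c d)).path ≫ (Edge.eps n a m c d).path)

/-- The base category: the free category on the graph, modulo the equations. -/
abbrev Base : Type := CategoryTheory.Quotient Rel

/-- A vertex as an object of the base category. -/
abbrev Base.of (x : Vertex) : Base :=
  (CategoryTheory.Quotient.functor Rel).obj ((Paths.of Vertex).obj x)

/-- An edge as a morphism of the base category. -/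
abbrev Edge.hom {x y : Vertex} (e : Edge x y) : Base.of x ⟶ Base.of y :=
  (CategoryTheory.Quotient.functor Rel).map e.path

/-- The dimension of a vertex. -/
def Vertex.dim : Vertex → ℕ
  | star => 0
  | agent _ => 1
  | basic _ => 2
  | fork _ => 3
  | sync _ _ _ _ _ => 4

/-- The dimension of an object of the base category. -/
def Base.dim (x : Base) : ℕ := Vertex.dim x.as

/-! ### Presheaves and positions -/

/-- Presheaves on the base category. -/
abbrev Psh : Type 1 := Baseᵒᵖ ⥤ Type

/-- The representable presheaf on a vertex. -/
abbrev rep (x : Vertex) : Psh := yoneda.obj (Base.of x)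

/-- The map of representable presheaves given by an edge. -/
abbrev Edge.map {x y : Vertex} (e : Edge x y) : rep x ⟶ rep y := yoneda.map e.hom

/-- A presheaf is finite when its set of elements is. -/
def IsFinite (F : Psh) : Prop := Finite (Σ c : Base, F.obj (op c))

/-- Positions: finite presheaves that are empty in dimensions greater than `1`. -/
def IsPosition (F : Psh) : Prop := IsFinite F ∧ ∀ c : Base, 1 < c.dim → IsEmpty (F.obj (op c))

/-- `1`-injective maps: injective in all positive dimensions. -/
def OneInjective {F G : Psh} (f : F ⟶ G) : Prop :=
  ∀ c : Base, 0 < c.dim → Function.Injective (f.app (op c))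

/-- The interface of a presheaf: the coproduct of one copy of `⋆` for each of its channels. -/
def interface (F : Psh) : Psh := ∐ fun _ : F.obj (op (Base.of .star)) => rep .star

/-- The canonical map from the interface of a presheaf. -/
def interfaceMap (F : Psh) : interface F ⟶ F := Sigma.desc fun x => yonedaEquiv.symm x

/-! ### Seeds -/

/-- Selecting `p` channels of the representable `n`-ary agent. -/
def select {p : ℕ} (n : ℕ) (a : Fin p → Fin n) : (∐ fun _ : Fin p => rep .star) ⟶ rep (.agent n) :=
  Sigma.desc fun k => (Edge.chan n (a k)).map

/-- The position made of an `m`-ary agent `x` and an `n`-ary agent `y`, quotiented by the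
equations `x · s_{a k} = y · s_{c k}`. -/
def glue {p : ℕ} (m n : ℕ) (a : Fin p → Fin m) (c : Fin p → Fin n) : Psh :=
  pushout (select m a) (select n c)

/-- The copairing of maps out of the two agents of a glued position. -/
def glueDesc {p m n : ℕ} {a : Fin p → Fin m} {c : Fin p → Fin n} {F : Psh}
    (f : rep (.agent m) ⟶ F) (g : rep (.agent n) ⟶ F)
    (h : ∀ k, (Edge.chan m (a k)).map ≫ f = (Edge.chan n (c k)).map ≫ g) :
    glue m n a c ⟶ F :=
  pushout.desc f g (Sigma.hom_ext _ _ fun k => by simpa [select] using h k)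

lemma keep_eq {n n' : ℕ} (v : Basic n n') (i : Fin n) :
    (Edge.chan n' (v.keep i)).map ≫ (Edge.s v).map =
      (Edge.chan n i).map ≫ (Edge.t v).map := by
  have h := CategoryTheory.Quotient.sound Rel (Rel.keep v i)
  simpa only [Functor.map_comp] using congrArg yoneda.map h

lemma fork_eq (n : ℕ) :
    (Edge.t (.forkLeft n)).map ≫ (Edge.l n).map = (Edge.t (.forkRight n)).map ≫ (Edge.r n).map := by
  have h := CategoryTheory.Quotient.sound Rel (Rel.fork n)
  simpa only [Functor.map_comp] using congrArg yoneda.map h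

lemma subject_eq (n : ℕ) (a : Fin n) (m : ℕ) (c d : Fin m) :
    (Edge.chan n a).map ≫ (Edge.t (.inp n a)).map ≫ (Edge.rho n a m c d).map =
      (Edge.chan m c).map ≫ (Edge.t (.out m c d)).map ≫ (Edge.eps n a m c d).map := by
  have h := CategoryTheory.Quotient.sound Rel (Rel.subject n a m c d)
  simpa only [Functor.map_comp] using congrArg yoneda.map h

lemma object_eq (n : ℕ) (a : Fin n) (m : ℕ) (c d : Fin m) :
    (Edge.chan (n + 1) (Fin.last n)).map ≫ (Edge.s (.inp n a)).map ≫ (Edge.rho n a m c d).map =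
      (Edge.chan m d).map ≫ (Edge.s (.out m c d)).map ≫ (Edge.eps n a m c d).map := by
  have h := CategoryTheory.Quotient.sound Rel (Rel.object n a m c d)
  simpa only [Functor.map_comp] using congrArg yoneda.map h

/-- Final position of a fork: two `n`-ary agents sharing all their channels in order. -/
abbrev forkFinal (n : ℕ) : Psh := glue n n (id : Fin n → Fin n) id

/-- The upper leg `[l s, r s]` of the fork. -/
def forkS (n : ℕ) : forkFinal n ⟶ rep (.fork n) :=
  glueDesc ((Edge.s (.forkLeft n)).map ≫ (Edge.l n).map)
    ((Edge.s (.forkRight n)).map ≫ (Edge.r n).map) fun k => by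
      have h1 := keep_eq (.forkLeft n) k
      have h2 := keep_eq (.forkRight n) k
      have h3 := fork_eq n
      exact (congrArg (· ≫ (Edge.l n).map) h1).trans
        ((congrArg ((Edge.chan n k).map ≫ ·) h3).trans
          (congrArg (· ≫ (Edge.r n).map) h2).symm)

/-- The lower leg `l t = r t` of the fork. -/
def forkT (n : ℕ) : rep (.agent n) ⟶ rep (.fork n) := (Edge.t (.forkLeft n)).map ≫ (Edge.l n).map

/-- Initial position of a synchronisation: the sender's `c`th channel is the receiver's `a`th. -/
abbrev syncInitial (n : ℕ) (a : Fin n) (m : ℕ) (c : Fin m) : Psh := glue m n ![c] ![a]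

/-- Final position of a synchronisation: moreover, the sender's `d`th channel is the last one of
the receiver. -/
abbrev syncFinal (n : ℕ) (a : Fin n) (m : ℕ) (c d : Fin m) : Psh :=
  glue m (n + 1) ![c, d] ![a.castSucc, Fin.last n]

/-- The lower leg `[ε t, ρ t]` of the synchronisation. -/
def syncT (n : ℕ) (a : Fin n) (m : ℕ) (c d : Fin m) :
    syncInitial n a m c ⟶ rep (.sync n a m c d) :=
  glueDesc ((Edge.t (.out m c d)).map ≫ (Edge.eps n a m c d).map)
    ((Edge.t (.inp n a)).map ≫ (Edge.rho n a m c d).map) fun k => by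
      fin_cases k
      exact (subject_eq n a m c d).symm

/-- The upper leg `[ε s, ρ s]` of the synchronisation. -/
def syncS (n : ℕ) (a : Fin n) (m : ℕ) (c d : Fin m) :
    syncFinal n a m c d ⟶ rep (.sync n a m c d) :=
  glueDesc ((Edge.s (.out m c d)).map ≫ (Edge.eps n a m c d).map)
    ((Edge.s (.inp n a)).map ≫ (Edge.rho n a m c d).map) fun k => by
      fin_cases k
      · have h1 := keep_eq (.out m c d) c
        have h2 := keep_eq (.inp n a) a
        exact (congrArg (· ≫ (Edge.eps n a m c d).map) h1).trans
          ((subject_eq n a m c d).symm.trans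
            (congrArg (· ≫ (Edge.rho n a m c d).map) h2).symm)
      · exact (object_eq n a m c d).symm

/-- Seeds: the cospans `Y ⟶ M ⟵ X` (with `X` initial and `Y` final) giving the local forms of
actions. -/
inductive IsSeed : ∀ {Y M X : Psh}, (Y ⟶ M) → (X ⟶ M) → Prop
  | basic {n n' : ℕ} (v : Basic n n') : IsSeed (Edge.s v).map (Edge.t v).map
  | fork (n : ℕ) : IsSeed (forkS n) (forkT n)
  | sync (n : ℕ) (a : Fin n) (m : ℕ) (c d : Fin m) : IsSeed (syncS n a m c d) (syncT n a m c d)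

/-! ### Actions and traces -/

/-- Actions: the cospans obtained from a seed `Y₀ ⟶ M₀ ⟵ X₀` by pushing it along a map
`I ⟶ Z` from its interface `I` (that of `X₀`) to some position `Z`. The map `j` is the (unique)
factorisation of `I ⟶ X₀ ⟶ M₀` through `Y₀`. -/
def IsAction {Y M X : Psh} (s : Y ⟶ M) (t : X ⟶ M) : Prop :=
  ∃ (Y₀ M₀ X₀ : Psh) (s₀ : Y₀ ⟶ M₀) (t₀ : X₀ ⟶ M₀) (j : interface X₀ ⟶ Y₀)
    (Z : Psh) (z : interface X₀ ⟶ Z)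
    (y : Y₀ ⟶ Y) (m : M₀ ⟶ M) (x : X₀ ⟶ X) (zY : Z ⟶ Y) (zM : Z ⟶ M) (zX : Z ⟶ X),
    IsSeed s₀ t₀ ∧ j ≫ s₀ = interfaceMap X₀ ≫ t₀ ∧ IsPosition Z ∧
    IsPushout j z y zY ∧
    IsPushout (interfaceMap X₀ ≫ t₀) z m zM ∧
    IsPushout (interfaceMap X₀) z x zX ∧
    y ≫ s = s₀ ≫ m ∧ zY ≫ s = zM ∧ x ≫ t = t₀ ≫ m ∧ zX ≫ t = zM

/-- Traces: the cospans `Y ⟶ U ⟵ X` that are isomorphic to a finite, possibly empty composite of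
actions. Composition of cospans is by pushout, so closure under isomorphism is built into
the second clause; in the first one, a cospan isomorphic to an identity is one whose legs are
both isomorphisms. -/
inductive IsTrace : ∀ {Y U X : Psh}, (Y ⟶ U) → (X ⟶ U) → Prop
  | id {Y U X : Psh} (s : Y ⟶ U) (t : X ⟶ U) (hX : IsPosition X) (hs : IsIso s) (ht : IsIso t) :
      IsTrace s t
  | comp {Y V Z M X U : Psh} (s₁ : Z ⟶ M) (t₁ : X ⟶ M) (s₂ : Y ⟶ V) (t₂ : Z ⟶ V)
      (m : M ⟶ U) (v : V ⟶ U) (hM : IsAction s₁ t₁) (hV : IsTrace s₂ t₂)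
      (hU : IsPushout s₁ t₂ m v) : IsTrace (s₂ ≫ v) (t₁ ≫ m)

/-! ### The factorisation system -/

/-- `f` is right-orthogonal to `t`: commuting squares from `t` to `f` have unique fillers. -/
def Orthogonal {A B C D : Psh} (t : A ⟶ B) (f : C ⟶ D) : Prop :=
  ∀ (u : A ⟶ C) (v : B ⟶ D), u ≫ f = t ≫ v → ∃! k : B ⟶ C, t ≫ k = u ∧ k ≫ f = v

/-- The lower legs of seeds. -/
def V₀ : MorphismProperty Psh := fun _ M t => ∃ (Y : Psh) (s : Y ⟶ M), IsSeed s t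

/-- The maps that are right-orthogonal to all lower legs of seeds. -/
def H : MorphismProperty Psh := fun _ _ f => ∀ ⦃X M : Psh⦄ (t : X ⟶ M), V₀ t → Orthogonal t f

/-- The maps that are left-orthogonal to all maps in `H`. -/
def V : MorphismProperty Psh := fun _ _ t => ∀ ⦃C D : Psh⦄ (f : C ⟶ D), H f → Orthogonal t f

lemma V_of_isIso {A B : Psh} (t : A ⟶ B) [IsIso t] : V t := by
  intro C D f _ u v h
  refine ⟨inv t ≫ u, ⟨by simp, by simp [h]⟩, ?_⟩
  rintro k ⟨rfl, _⟩
  simp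

lemma V_comp {A B C : Psh} (t : A ⟶ B) (t' : B ⟶ C) (h : V t) (h' : V t') : V (t ≫ t') := by
  intro D E f hf u v w
  obtain ⟨k, ⟨hk, hk'⟩, ku⟩ := h f hf u (t' ≫ v) (by simpa using w)
  obtain ⟨k₂, ⟨hk₂, hk₂'⟩, ku₂⟩ := h' f hf k v hk'
  refine ⟨k₂, ⟨by simp [hk₂, hk], hk₂'⟩, ?_⟩
  rintro q ⟨hq, hq'⟩
  refine ku₂ q ⟨ku _ ⟨by simpa using hq, by simp [hq']⟩, hq'⟩

lemma V_pushout {A B C D : Psh} {t : A ⟶ B} {x : A ⟶ C} {y : B ⟶ D} {t' : C ⟶ D}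
    (sq : IsPushout t x y t') (h : V t) : V t' := by
  intro E F f hf u v w
  obtain ⟨k, ⟨hk, hk'⟩, ku⟩ := h f hf (x ≫ u) (y ≫ v) (by rw [Category.assoc, w, sq.w_assoc])
  refine ⟨sq.desc k u hk, ⟨by simp, sq.hom_ext (by simp [hk']) (by simp [w])⟩, ?_⟩
  rintro q ⟨hq, hq'⟩
  refine sq.hom_ext ?_ (by simpa using hq)
  rw [sq.inl_desc]
  exact ku _ ⟨by rw [sq.w_assoc, hq], by rw [Category.assoc, hq']⟩

lemma V_of_seed {Y M X : Psh} {s : Y ⟶ M} {t : X ⟶ M} (h : IsSeed s t) : V t :=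
  fun _ _ _ hf => hf t ⟨_, s, h⟩

lemma V_of_action {Y M X : Psh} {s : Y ⟶ M} {t : X ⟶ M} (h : IsAction s t) : V t := by
  obtain ⟨Y₀, M₀, X₀, s₀, t₀, j, Z, z, y, m, x, zY, zM, zX, hs, -, -, -, hM, hX, -, -, e, e'⟩ := h
  exact V_pushout (IsPushout.of_top (e' ▸ hM.flip) e hX.flip).flip (V_of_seed hs)

lemma V_of_trace {Y U X : Psh} {s : Y ⟶ U} {t : X ⟶ U} (h : IsTrace s t) : V t := by
  induction h with
  | id s t _ _ ht => exact V_of_isIso t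
  | comp s₁ t₁ s₂ t₂ m v hM _ hU ih => exact V_comp _ _ (V_of_action hM) (V_pushout hU.flip ih)

/-! ### The categories of positions and of vertical morphisms -/

/-- Positions, with all natural transformations as morphisms: the horizontal category of the
double categories `𝔻⁰` and `𝔻¹`. -/
structure Position : Type 1 where
  psh : Psh
  isPosition : IsPosition psh

instance : Category Position where
  Hom X Y := X.psh ⟶ Y.psh
  id X := 𝟙 X.psh
  comp f g := f ≫ g

/-- Positions, with `1`-injective maps as morphisms: the category `𝔻_h`. -/
structure Dh : Type 1 where
  position : Position

lemma OneInjective.id (F : Psh) : OneInjective (𝟙 F) := fun _ _ => Function.injective_id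

lemma OneInjective.comp {F G K : Psh} {f : F ⟶ G} {g : G ⟶ K} (hf : OneInjective f)
    (hg : OneInjective g) : OneInjective (f ≫ g) := fun c hc => (hg c hc).comp (hf c hc)

instance : Category Dh where
  Hom X Y := {h : X.position.psh ⟶ Y.position.psh // OneInjective h}
  id X := ⟨𝟙 _, .id _⟩
  comp f g := ⟨f.1 ≫ g.1, f.2.comp g.2⟩

/-- Vertical morphisms `final ⇸ initial` of `𝔻⁰`: cospans `final ⟶ tip ⟵ initial` of presheaves
between positions. -/
structure VerticalMorphism : Type 1 where
  final : Position
  tip : Psh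
  initial : Position
  s : final.psh ⟶ tip
  t : initial.psh ⟶ tip

/-- Double cells of `𝔻⁰`: the commuting diagrams
```
  U.final   -- top -->  W.final
     | s                  | s
   U.tip    -- mid -->   W.tip
     | t                  | t
  U.initial -- bot --> W.initial
```
-/
@[ext]
structure Cell (U W : VerticalMorphism) : Type where
  top : U.final.psh ⟶ W.final.psh
  mid : U.tip ⟶ W.tip
  bot : U.initial.psh ⟶ W.initial.psh
  comm_s : top ≫ W.s = U.s ≫ mid
  comm_t : bot ≫ W.t = U.t ≫ mid

/-- The identity cell. -/
def Cell.id (U : VerticalMorphism) : Cell U U where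
  top := 𝟙 _
  mid := 𝟙 _
  bot := 𝟙 _
  comm_s := by simp
  comm_t := by simp

/-- Horizontal composition of cells. -/
def Cell.comp {U W T : VerticalMorphism} (α : Cell U W) (β : Cell W T) : Cell U T where
  top := α.top ≫ β.top
  mid := α.mid ≫ β.mid
  bot := α.bot ≫ β.bot
  comm_s := by rw [Category.assoc, β.comm_s, ← Category.assoc, α.comm_s, Category.assoc]
  comm_t := by rw [Category.assoc, β.comm_t, ← Category.assoc, α.comm_t, Category.assoc]

/-- A cell is `1`-injective when its three components are. -/
def Cell.OneInj {U W : VerticalMorphism} (α : Cell U W) : Prop :=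
  OneInjective α.top ∧ OneInjective α.mid ∧ OneInjective α.bot

/-- Objects of `𝔻¹_H`: the vertical morphisms whose lower leg is in `V`. -/
structure D1H : Type 1 where
  vert : VerticalMorphism
  mem_V : V vert.t

/-- The category `𝔻¹_H`: its morphisms are all double cells. -/
instance : Category D1H where
  Hom U W := Cell U.vert W.vert
  id U := Cell.id U.vert
  comp α β := Cell.comp α β
  id_comp _ := Cell.ext (Category.id_comp _) (Category.id_comp _) (Category.id_comp _)
  comp_id _ := Cell.ext (Category.comp_id _) (Category.comp_id _) (Category.comp_id _)
  assoc _ _ _ := Cell.ext (Category.assoc _ _ _) (Category.assoc _ _ _) (Category.assoc _ _ _)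

/-- Objects of `𝔻_H`: the traces. -/
structure DH : Type 1 where
  vert : VerticalMorphism
  isTrace : IsTrace vert.s vert.t

/-- The category `𝔻_H`: its morphisms are the `1`-injective double cells. -/
instance : Category DH where
  Hom U W := {α : Cell U.vert W.vert // α.OneInj}
  id U := ⟨Cell.id U.vert, .id _, .id _, .id _⟩
  comp α β := ⟨Cell.comp α.1 β.1, α.2.1.comp β.2.1, α.2.2.1.comp β.2.2.1, α.2.2.2.comp β.2.2.2⟩
  id_comp _ := Subtype.ext <|
    Cell.ext (Category.id_comp _) (Category.id_comp _) (Category.id_comp _)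
  comp_id _ := Subtype.ext <|
    Cell.ext (Category.comp_id _) (Category.comp_id _) (Category.comp_id _)
  assoc _ _ _ := Subtype.ext <|
    Cell.ext (Category.assoc _ _ _) (Category.assoc _ _ _) (Category.assoc _ _ _)

/-! ### The codomain functors -/

/-- The codomain functor `𝔻¹_H ⥤ 𝔻¹_h`, sending a vertical morphism to its initial position. -/
def cod1 : D1H ⥤ Position where
  obj U := U.vert.initial
  map α := α.bot

/-- The codomain functor `𝔻_H ⥤ 𝔻_h`, sending a trace to its initial position. -/
def cod : DH ⥤ Dh where
  obj U := ⟨U.vert.initial⟩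
  map α := ⟨α.1.bot, α.2.2.2⟩

/-- The inclusion of `𝔻_H` into `𝔻¹_H`. -/
def inclH : DH ⥤ D1H where
  obj U := ⟨U.vert, V_of_trace U.isTrace⟩
  map α := α.1

/-- The inclusion of `𝔻_h` into `𝔻¹_h`. -/
def inclh : Dh ⥤ Position where
  obj X := X.position
  map h := h.1

/-- A functor exhibits its source as a subcategory of its target. -/
structure IsSubcategory {A B : Type*} [Category* A] [Category* B] (i : A ⥤ B) : Prop where
  injective_obj : Function.Injective i.obj
  faithful : i.Faithful

/-- The functor `p' : E' ⥤ B'` is a subfibration of `p : E ⥤ B`, along the inclusions `i` and `j`: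
`E'` and `B'` are subcategories of `E` and `B`, `p'` is the restriction of `p`, it is a fibration,
and the `p'`-cartesian morphisms are `p`-cartesian. Cartesian morphisms are those with the
universal property with respect to all morphisms of the base, which Mathlib calls strongly
cartesian. -/
structure IsSubfibration {E' B' E B : Type*} [Category* E'] [Category* B'] [Category* E]
    [Category* B] (p' : E' ⥤ B') (p : E ⥤ B) (i : E' ⥤ E) (j : B' ⥤ B) : Prop where
  subcategory_total : IsSubcategory i
  subcategory_base : IsSubcategory j
  comm : i ⋙ p = p' ⋙ j
  isFibered : p'.IsFibered
  isCartesian {e₁ e : E'} (r : e₁ ⟶ e) (hr : p'.IsStronglyCartesian (p'.map r) r) :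
    p.IsStronglyCartesian (p.map (i.map r)) (i.map r)

end PiTraces

end

/-!
The cartesian lifting of `h : X' ⟶ X` at a vertical morphism `Y → U ← X` is obtained by factoring
the composite `X' → X → U` as a map in `V` followed by a map `U' ⟶ U` in `H`, and by pulling back
the tip `Y`. The content of the theorem is that for a trace `U` and a `1`-injective `h` the map in
`V` is again the lower leg of a trace.

*Tips are redundant.* The upper leg of a trace is determined by its apex: it is the inclusion of
all channels together with all agents that are not consumed, that is, are not the agent before
some shape of dimension `2` (`IsFinalLeg`, `IsTrace.properties`). Maps of presheaves preserve
consumed agents, and maps in `H` also reflect them (`H.consumed`), so that a map in `H` between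
the apices of traces restricts to the tips (`IsFinalLeg.exists_map`), and a double cell whose
middle component is in `H` is cartesian (`isStronglyCartesian_of_mem_H`). What remains is to
factor `X' → X → U` as the lower leg of a trace followed by a map in `H`; such a factorisation with
`1`-injective second map is a restriction of `U` along `h` (`IsRestriction`).

*Restrictions compose.* If `U` is an action followed by a trace `W`, then one restricts the action,
and then `W` along the map obtained between the tips; the pushout of the two restrictions is a
restriction of `U` (`HasRestrictions.comp`). By induction on traces it suffices to restrict actions
(`IsTrace.hasRestrictions`).

*Restrictions of actions.* An action is a seed glued to a position along its own initial position,
with the upper leg determined as above (`IsGluing`). Since `h` is `1`-injective, at most one agent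
of `X'` lies over each agent taking part in the action. If these all have lifts, which in the case
of a synchronisation also share the channel used, then the initial position of the seed lifts to
`X'` and the restriction is the same seed glued to `X'`. If no agent lifts, the restriction is the
identity. In the remaining case of a synchronisation, where only one of the agents lifts, or where
both do without sharing the channel (`exists_restriction_sync_of_not_lift`), the restriction
consists of the corresponding input or output actions, carried out independently of each other.

*Cartesianness in `𝔻_H`.* The first factor of a `1`-injective composite is `1`-injective, so that
the fillers in `𝔻¹_H` are in `𝔻_H` (`isStronglyCartesian_cod`). Uniqueness of cartesian liftings up
to isomorphism then gives the statements about arbitrary ones.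
-/

noncomputable section

namespace PiTraces

/-! ### Morphisms of the base category -/

/-- The channels known before an action are channels of the agent after it. -/
lemma hom_keep {n n' : ℕ} (v : Basic n n') (i : Fin n) :
    (Edge.chan n' (v.keep i)).hom ≫ (Edge.s v).hom =
      (Edge.chan n i).hom ≫ (Edge.t v).hom := by
  simpa only [Functor.map_comp] using CategoryTheory.Quotient.sound Rel (Rel.keep v i)

lemma hom_fork (n : ℕ) :
    (Edge.t (.forkLeft n)).hom ≫ (Edge.l n).hom = (Edge.t (.forkRight n)).hom ≫ (Edge.r n).hom := by
  simpa only [Functor.map_comp] using CategoryTheory.Quotient.sound Rel (Rel.fork n)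

/-- The normal forms of the morphisms of the base category: channels are always reached through
the agents after the action, and the agent before a fork through its left half. The channels shared
by the two agents of a synchronisation have one normal form for each. -/
inductive IsNormal : ∀ {x y : Vertex}, (Base.of x ⟶ Base.of y) → Prop
  | id (x : Vertex) : IsNormal (𝟙 (Base.of x))
  | chan (n : ℕ) (i : Fin n) : IsNormal (Edge.chan n i).hom
  | t {n n' : ℕ} (v : Basic n n') : IsNormal (Edge.t v).hom
  | s {n n' : ℕ} (v : Basic n n') : IsNormal (Edge.s v).hom
  | l (n : ℕ) : IsNormal (Edge.l n).hom
  | r (n : ℕ) : IsNormal (Edge.r n).hom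
  | rho (n : ℕ) (a : Fin n) (m : ℕ) (c d : Fin m) : IsNormal (Edge.rho n a m c d).hom
  | eps (n : ℕ) (a : Fin n) (m : ℕ) (c d : Fin m) : IsNormal (Edge.eps n a m c d).hom
  | chan_s {n n' : ℕ} (v : Basic n n') (i : Fin n') :
      IsNormal ((Edge.chan n' i).hom ≫ (Edge.s v).hom)
  | chan_s_l (n : ℕ) (i : Fin n) :
      IsNormal ((Edge.chan n i).hom ≫ (Edge.s (.forkLeft n)).hom ≫ (Edge.l n).hom)
  | chan_s_rho (n : ℕ) (a : Fin n) (m : ℕ) (c d : Fin m) (i : Fin (n + 1)) :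
      IsNormal ((Edge.chan (n + 1) i).hom ≫ (Edge.s (.inp n a)).hom ≫ (Edge.rho n a m c d).hom)
  | chan_s_eps (n : ℕ) (a : Fin n) (m : ℕ) (c d : Fin m) (i : Fin m) :
      IsNormal ((Edge.chan m i).hom ≫ (Edge.s (.out m c d)).hom ≫ (Edge.eps n a m c d).hom)
  | t_l (n : ℕ) : IsNormal ((Edge.t (.forkLeft n)).hom ≫ (Edge.l n).hom)
  | s_l (n : ℕ) : IsNormal ((Edge.s (.forkLeft n)).hom ≫ (Edge.l n).hom)
  | s_r (n : ℕ) : IsNormal ((Edge.s (.forkRight n)).hom ≫ (Edge.r n).hom)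
  | t_rho (n : ℕ) (a : Fin n) (m : ℕ) (c d : Fin m) :
      IsNormal ((Edge.t (.inp n a)).hom ≫ (Edge.rho n a m c d).hom)
  | s_rho (n : ℕ) (a : Fin n) (m : ℕ) (c d : Fin m) :
      IsNormal ((Edge.s (.inp n a)).hom ≫ (Edge.rho n a m c d).hom)
  | t_eps (n : ℕ) (a : Fin n) (m : ℕ) (c d : Fin m) :
      IsNormal ((Edge.t (.out m c d)).hom ≫ (Edge.eps n a m c d).hom)
  | s_eps (n : ℕ) (a : Fin n) (m : ℕ) (c d : Fin m) :
      IsNormal ((Edge.s (.out m c d)).hom ≫ (Edge.eps n a m c d).hom)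

lemma IsNormal.comp_edge {x y z : Vertex} {φ : Base.of x ⟶ Base.of y} (h : IsNormal φ)
    (e : Edge y z) : IsNormal (φ ≫ e.hom) := by
  cases e with
  | chan n i => cases h; rw [Category.id_comp]; exact .chan n i
  | t v =>
    cases h with
    | id => rw [Category.id_comp]; exact .t v
    | chan n i => rw [← hom_keep]; exact .chan_s v _
  | s v =>
    cases h with
    | id => rw [Category.id_comp]; exact .s v
    | chan n i => exact .chan_s v _
  | l n =>
    cases h with
    | id => rw [Category.id_comp]; exact .l n
    | t => exact .t_l n
    | s => exact .s_l n
    | chan_s _ i => rw [Category.assoc]; exact .chan_s_l n i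
  | r n =>
    cases h with
    | id => rw [Category.id_comp]; exact .r n
    | t => rw [← hom_fork]; exact .t_l n
    | s => exact .s_r n
    | chan_s _ i =>
      have := hom_keep (.forkRight n) i
      have h' := hom_keep (.forkLeft n) i
      rw [show (Basic.forkRight n).keep i = i from rfl] at this
      rw [show (Basic.forkLeft n).keep i = i from rfl] at h'
      rw [this, Category.assoc, ← hom_fork, ← Category.assoc, ← h', Category.assoc]
      exact .chan_s_l n i
  | rho n a m c d =>
    cases h with
    | id => rw [Category.id_comp]; exact .rho ..
    | t => exact .t_rho ..
    | s => exact .s_rho ..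
    | chan_s _ i => rw [Category.assoc]; exact .chan_s_rho ..
  | eps n a m c d =>
    cases h with
    | id => rw [Category.id_comp]; exact .eps ..
    | t => exact .t_eps ..
    | s => exact .s_eps ..
    | chan_s _ i => rw [Category.assoc]; exact .chan_s_eps ..

lemma isNormal {x y : Vertex} (φ : Base.of x ⟶ Base.of y) : IsNormal φ := by
  obtain ⟨p, rfl⟩ := (CategoryTheory.Quotient.functor Rel).map_surjective φ
  change Quiver.Path x y at p
  induction p with
  | nil => exact .id x
  | cons p e ih => exact ih.comp_edge e

/-- Names of the agents of a representable presheaf. For a shape of dimension `2`, `false` and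
`true` stand for the agents before and after the action. For a fork, `none` is the agent before it,
and `some false` and `some true` are its left and right halves. For a synchronisation, the first
component tells the receiver (`true`) from the sender, and the second one is as in dimension `2`.
-/
def Label : Vertex → Type
  | .star => Empty
  | .agent _ => Unit
  | .basic _ => Bool
  | .fork _ => Option Bool
  | .sync _ _ _ _ _ => Bool × Bool

/-- The effect on names of agents of mapping along an edge. -/
def Edge.label {x y : Vertex} : Edge x y → Label x → Label y
  | .chan _ _ => Empty.elim
  | .t _ => fun _ => false
  | .s _ => fun _ => true
  | .l _ => fun | true => some false | false => none
  | .r _ => fun | true => some true | false => none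
  | .rho _ _ _ _ _ => fun b => (true, b)
  | .eps _ _ _ _ _ => fun b => (false, b)

/-- The functor separating the agents of representable presheaves. -/
def labelFunctor : Base ⥤ Type :=
  CategoryTheory.Quotient.lift Rel
    (Paths.lift { obj := Label, map := fun e => ↾(Edge.label e) }) (by
      intro x y p q h
      cases h <;> simp only [Edge.path, Paths.of_map] <;> ext u
      · exact Empty.elim u
      · rfl
      · exact Empty.elim u
      · exact Empty.elim u)

/-- Names of the channels of a representable presheaf. In a synchronisation, these are the
channels of the sender, and those of the receiver but for the `a`th. -/
def ChannelName : Vertex → Type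
  | .star => Unit
  | .agent n => Fin n
  | .basic (n' := n') _ => Fin n'
  | .fork n => Fin n
  | .sync n _ m _ _ => Fin m ⊕ Fin n

/-- The name of the `j`th channel of the receiver before a synchronisation. -/
def receiverChannel {n m : ℕ} (a : Fin n) (c : Fin m) (j : Fin n) : Fin m ⊕ Fin n :=
  if j = a then .inl c else .inr j

/-- The effect on names of channels of mapping along an edge. -/
def Edge.channelName {x y : Vertex} : Edge x y → ChannelName x → ChannelName y
  | .chan _ i => fun _ => i
  | .t v => v.keep
  | .s _ => id
  | .l _ => id
  | .r _ => id
  | .rho _ a _ c d => Fin.lastCases (.inl d) (receiverChannel a c)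
  | .eps _ _ _ _ _ => .inl

/-- The functor separating the channels of representable presheaves. -/
def channelFunctor : Base ⥤ Type :=
  CategoryTheory.Quotient.lift Rel
    (Paths.lift { obj := ChannelName, map := fun e => ↾(Edge.channelName e) }) (by
      intro x y p q h
      cases h <;> simp only [Edge.path, Paths.of_map] <;> ext u
      · rfl
      · rfl
      · rename_i n a m c d
        change Fin.lastCases (motive := fun _ => Fin m ⊕ Fin n) (.inl d) (receiverChannel a c)
          a.castSucc = Sum.inl c
        simp [receiverChannel]
      · rename_i n a m c d
        change Fin.lastCases (motive := fun _ => Fin m ⊕ Fin n) (.inl d) (receiverChannel a c)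
          (Fin.last n) = Sum.inl d
        simp)

/-- The name of a channel of a representable presheaf. -/
def channelName {x : Vertex} (φ : Base.of .star ⟶ Base.of x) : ChannelName x :=
  channelFunctor.map φ ()

/-- The name of an agent of a representable presheaf. -/
def label {k : ℕ} {x : Vertex} (φ : Base.of (.agent k) ⟶ Base.of x) : Label x :=
  labelFunctor.map φ ()

lemma label_comp {k : ℕ} {x y : Vertex} (φ : Base.of (.agent k) ⟶ Base.of x) (e : Edge x y) :
    label (φ ≫ e.hom) = e.label (label φ) := by
  change labelFunctor.map (φ ≫ e.hom) () = _
  rw [Functor.map_comp]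
  rfl

lemma label_injective {k : ℕ} {x : Vertex} : Function.Injective (label (k := k) (x := x)) := by
  intro φ ψ h
  cases isNormal φ <;> cases isNormal ψ <;> first | rfl | cases h

/-! ### Pushouts and monomorphisms of presheaves -/

lemma mono_iff {F G : Psh} (f : F ⟶ G) : Mono f ↔ ∀ c, Function.Injective (f.app c) := by
  simp only [NatTrans.mono_iff_mono_app, mono_iff_injective]

lemma app_injective {F G : Psh} (f : F ⟶ G) [Mono f] (c) : Function.Injective (f.app c) :=
  (mono_iff f).1 ‹_› c

lemma app_eq {F G : Psh} {f g : F ⟶ G} (h : f = g) (c) (x : F.obj c) : f.app c x = g.app c x := by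
  rw [h]

lemma hom_ext_of_vertices {F G : Psh} {f g : F ⟶ G}
    (h : ∀ (x : Vertex) (e : F.obj (op (Base.of x))), f.app _ e = g.app _ e) : f = g :=
  NatTrans.ext (funext fun c => ConcreteCategory.hom_ext _ _ fun e => h c.unop.as e)

lemma app_map {F G : Psh} (f : F ⟶ G) {x y : Vertex} (φ : Base.of x ⟶ Base.of y)
    (e : F.obj (op (Base.of y))) :
    f.app (op (Base.of x)) (F.map φ.op e) = G.map φ.op (f.app (op (Base.of y)) e) :=
  NatTrans.naturality_apply f φ.op e

/-- A map factors through a monomorphism as soon as its elements do. -/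
lemma exists_lift {F G K : Psh} (i : F ⟶ G) [Mono i] (f : K ⟶ G)
    (h : ∀ (x : Vertex) (e : K.obj (op (Base.of x))), ∃ y, i.app _ y = f.app _ e) :
    ∃ g : K ⟶ F, g ≫ i = f := by
  replace h : ∀ (c : Baseᵒᵖ) (e : K.obj c), ∃ y, i.app c y = f.app c e := fun c e => h c.unop.as e
  choose g hg using h
  refine ⟨{ app := fun c => ↾(g c), naturality := fun c d u => ?_ }, ?_⟩
  · ext x
    apply app_injective i
    change i.app d (g d (K.map u x)) = i.app d (F.map u (g c x))
    rw [hg, NatTrans.naturality_apply, NatTrans.naturality_apply, hg]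
  · ext c x
    exact hg c x

section

variable {A B C D : Psh} {f : A ⟶ B} {g : A ⟶ C} {i : B ⟶ D} {j : C ⟶ D}

lemma exists_or_of_isPushout (h : IsPushout f g i j) (c) (x : D.obj c) :
    (∃ y, i.app c y = x) ∨ ∃ y, j.app c y = x := by
  exact Types.eq_or_eq_of_isPushout (h.app c) x

lemma mono_of_isPushout (h : IsPushout f g i j) [Mono f] : Mono j := by
  rw [mono_iff]
  exact fun c => Types.pushoutCocone_inr_injective_of_isColimit (h.app c).isColimit
    (app_injective f c)

lemma exists_of_isPushout_of_eq (h : IsPushout f g i j) [Mono f] {c} {b : B.obj c} {b' : C.obj c}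
    (e : i.app c b = j.app c b') : ∃ a, f.app c a = b ∧ g.app c a = b' :=
  (Types.pushoutCocone_inl_eq_inr_iff_of_isColimit (h.app c).isColimit (app_injective f c) b b').1 e

lemma eq_or_exists_of_isPushout (h : IsPushout f g i j) {c} {b b' : B.obj c}
    (e : i.app c b = i.app c b') : b = b' ∨ ∃ a, f.app c a = b := by
  classical
  by_contra! hb
  -- The complement of the range of `f` is separated by a map collapsing everything else.
  let u : B.obj c ⟶ Option (B.obj c) := ↾fun y => if ∃ a, f.app c a = y then none else some y
  let v : C.obj c ⟶ Option (B.obj c) := ↾fun _ => none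
  have w : f.app c ≫ u = g.app c ≫ v := by
    refine ConcreteCategory.hom_ext _ _ fun a => ?_
    exact if_pos (c := ∃ a', f.app c a' = f.app c a) ⟨a, rfl⟩
  have hu : ∀ y, u y = (h.app c).desc u v w (i.app c y) := fun y =>
    (ConcreteCategory.congr_hom ((h.app c).inl_desc u v w) y).symm
  have huu : u b = u b' := by rw [hu, hu, e]
  change (if ∃ a, f.app c a = b then none else some b) =
    if ∃ a, f.app c a = b' then none else some b' at huu
  rw [if_neg (by simpa using hb.2)] at huu
  split_ifs at huu
  exact hb.1 (Option.some.inj huu)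

/-- A commutative square with monic horizontal legs is a pushout as soon as its elements are those
of one. -/
lemma isPushout_of_elements [Mono f] [Mono j] (w : f ≫ i = g ≫ j)
    (h₁ : ∀ (x : Vertex) (e : D.obj (op (Base.of x))), (∃ y, i.app _ y = e) ∨ ∃ y, j.app _ y = e)
    (h₂ : ∀ (x : Vertex) (b : B.obj (op (Base.of x))) (b' : C.obj (op (Base.of x))),
      i.app _ b = j.app _ b' → ∃ a, f.app _ a = b)
    (h₃ : ∀ (x : Vertex) (b b' : B.obj (op (Base.of x))), i.app _ b = i.app _ b' →
      b = b' ∨ ∃ a, f.app _ a = b) :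
    IsPushout f g i j := by
  refine .of_forall_isPushout_app fun c => ?_
  replace h₁ : ∀ e : D.obj c, (∃ y, i.app c y = e) ∨ ∃ y, j.app c y = e := h₁ c.unop.as
  replace h₂ : ∀ (b : B.obj c) (b' : C.obj c), i.app c b = j.app c b' → ∃ a, f.app c a = b :=
    h₂ c.unop.as
  replace h₃ : ∀ b b' : B.obj c, i.app c b = i.app c b' → b = b' ∨ ∃ a, f.app c a = b :=
    h₃ c.unop.as
  have : Mono (j.app c) := (mono_iff_injective _).2 (app_injective j c)
  have hpb : IsPullback (g.app c) (f.app c) (j.app c) (i.app c) := by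
    rw [Types.isPullback_iff]
    have w' : ∀ a, i.app c (f.app c a) = j.app c (g.app c a) := fun a => app_eq w c a
    refine ⟨(NatTrans.congr_app w c).symm, fun a a' h => app_injective f c h.2, fun b' b h => ?_⟩
    obtain ⟨a, rfl⟩ := h₂ b b' h.symm
    exact ⟨a, app_injective j c ((w' a).symm.trans h.symm), rfl⟩
  refine (Types.isPushout_of_isPullback_of_mono' hpb ?_ ?_).flip
  · ext x
    simpa using (h₁ x).symm
  · intro b b' hb _ h
    exact (h₃ b b' h).resolve_right fun ⟨a, ha⟩ => hb ⟨a, ha⟩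

lemma exists_of_isPullback {p : D ⟶ B} {q : D ⟶ C} {r : B ⟶ A} {r' : C ⟶ A}
    (h : IsPullback p q r r') {c} {b : B.obj c} {b' : C.obj c} (e : r.app c b = r'.app c b') :
    ∃ d, p.app c d = b ∧ q.app c d = b' :=
  Types.exists_of_isPullback (h.app c) b b' e

end

/-! ### Final legs -/

/-- The elements of a presheaf over a vertex. -/
abbrev Elem (F : Psh) (x : Vertex) : Type := F.obj (op (Base.of x))

/-- An agent is consumed when it is the agent before some shape of dimension `2`. Those in a fork
or a synchronisation are included, because the latter have faces of dimension `2`. -/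
def Consumed (U : Psh) {k : ℕ} (e : Elem U (.agent k)) : Prop :=
  ∃ (k' : ℕ) (v : Basic k k') (w : Elem U (.basic v)), U.map (Edge.t v).hom.op w = e

lemma Consumed.map {U W : Psh} (f : U ⟶ W) {k : ℕ} {e : Elem U (.agent k)} (h : Consumed U e) :
    Consumed W (f.app _ e) := by
  obtain ⟨k', v, w, rfl⟩ := h
  exact ⟨k', v, f.app _ w, (NatTrans.naturality_apply f _ w).symm⟩

/-- The elements of the final position of a presheaf: all its channels, and the agents that are
not consumed. -/
def finalElements (U : Psh) : ∀ x : Vertex, Set (Elem U x)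
  | .star => Set.univ
  | .agent _ => {e | ¬ Consumed U e}
  | .basic _ => ∅
  | .fork _ => ∅
  | .sync _ _ _ _ _ => ∅

lemma map_mem_finalElements (U : Psh) {x y : Vertex} (φ : Base.of x ⟶ Base.of y) {e : Elem U y}
    (he : e ∈ finalElements U y) : U.map φ.op e ∈ finalElements U x := by
  cases y with
  | star =>
    cases isNormal φ
    trivial
  | agent n =>
    cases isNormal φ with
    | id => simpa using he
    | chan => trivial
  | basic => exact he.elim
  | fork => exact he.elim
  | sync => exact he.elim

/-- The final position of a presheaf, as a subpresheaf. -/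
def finalSubfunctor (U : Psh) : Subfunctor U where
  obj c := finalElements U c.unop.as
  map {c d} φ _ he := map_mem_finalElements U (x := d.unop.as) (y := c.unop.as) φ.unop he

/-- Upper legs of traces are determined by their target: they are, up to isomorphism, the inclusion
of its final position. -/
structure IsFinalLeg {Y U : Psh} (s : Y ⟶ U) : Prop where
  mono : Mono s
  range_iff (x : Vertex) (e : Elem U x) : (∃ y, s.app _ y = e) ↔ e ∈ finalElements U x

lemma isFinalLeg_finalSubfunctor (U : Psh) : IsFinalLeg (finalSubfunctor U).ι where
  mono := (mono_iff _).2 fun _ _ _ h => Subtype.ext h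
  range_iff x e := ⟨by rintro ⟨y, rfl⟩; exact y.2, fun h => ⟨⟨e, h⟩, rfl⟩⟩

section

variable {Y U : Psh} {s : Y ⟶ U}

lemma IsFinalLeg.exists_star (hs : IsFinalLeg s) (e : Elem U .star) : ∃ y, s.app _ y = e :=
  (hs.range_iff _ _).2 trivial

lemma IsFinalLeg.exists_agent (hs : IsFinalLeg s) {k : ℕ} {e : Elem U (.agent k)}
    (he : ¬ Consumed U e) : ∃ y, s.app _ y = e :=
  (hs.range_iff _ _).2 he

lemma IsFinalLeg.not_consumed (hs : IsFinalLeg s) {k : ℕ} (y : Elem Y (.agent k)) :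
    ¬ Consumed U (s.app _ y) :=
  (hs.range_iff _ _).1 ⟨y, rfl⟩

lemma IsFinalLeg.isEmpty (hs : IsFinalLeg s) {x : Vertex} (hx : 1 < x.dim) :
    IsEmpty (Elem Y x) := by
  refine ⟨fun y => ?_⟩
  have := (hs.range_iff _ _).1 ⟨y, rfl⟩
  cases x with
  | star => simp [Vertex.dim] at hx
  | agent n => simp [Vertex.dim] at hx
  | basic => exact this
  | fork => exact this
  | sync => exact this

end

/-! ### Elements of representable presheaves and of glued positions -/

lemma hom_eq_empty {x y : Vertex} (h : y.dim < x.dim) : IsEmpty (Base.of x ⟶ Base.of y) :=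
  ⟨fun φ => by cases isNormal φ <;> simp [Vertex.dim] at h⟩

/-- Names of the agents before an action. -/
def IsConsumed : ∀ {x : Vertex}, Label x → Prop
  | .star, _ => False
  | .agent _, _ => False
  | .basic _, b => b = false
  | .fork _, o => o = none
  | .sync _ _ _ _ _, b => b.2 = false

lemma consumed_rep_iff {x : Vertex} {k : ℕ} (e : Elem (rep x) (.agent k)) :
    Consumed (rep x) e ↔ IsConsumed (label e) := by
  constructor
  · rintro ⟨k', v, w, rfl⟩
    cases isNormal (x := .basic v) w <;> rfl
  · intro h
    cases isNormal (x := .agent k) e with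
    | id => exact h.elim
    | t v => exact ⟨_, v, 𝟙 (Base.of _), Category.comp_id (Edge.t v).hom⟩
    | s => cases h
    | t_l => exact ⟨_, _, (Edge.l _).hom, rfl⟩
    | s_l => cases h
    | s_r => cases h
    | t_rho => exact ⟨_, _, (Edge.rho ..).hom, rfl⟩
    | s_rho => cases h
    | t_eps => exact ⟨_, _, (Edge.eps ..).hom, rfl⟩
    | s_eps => cases h

section

variable {p m n : ℕ} (a : Fin p → Fin m) (c : Fin p → Fin n)

/-- The first agent of a glued position. -/
def glueInl : rep (.agent m) ⟶ glue m n a c := pushout.inl _ _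

/-- The second agent of a glued position. -/
def glueInr : rep (.agent n) ⟶ glue m n a c := pushout.inr _ _

lemma glue_condition (k : Fin p) :
    (Edge.chan m (a k)).map ≫ glueInl a c = (Edge.chan n (c k)).map ≫ glueInr a c := by
  have := Sigma.ι (fun _ : Fin p => rep .star) k ≫=
    pushout.condition (f := select m a) (g := select n c)
  simp only [select, colimit.ι_desc_assoc, Discrete.functor_obj_eq_as, Cofan.mk_ι_app] at this
  exact this

variable {a c}

lemma glueInl_glueDesc {F : Psh} (f : rep (.agent m) ⟶ F) (g : rep (.agent n) ⟶ F)
    (h : ∀ k, (Edge.chan m (a k)).map ≫ f = (Edge.chan n (c k)).map ≫ g) :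
    glueInl a c ≫ glueDesc f g h = f := pushout.inl_desc _ _ _

lemma glueInr_glueDesc {F : Psh} (f : rep (.agent m) ⟶ F) (g : rep (.agent n) ⟶ F)
    (h : ∀ k, (Edge.chan m (a k)).map ≫ f = (Edge.chan n (c k)).map ≫ g) :
    glueInr a c ≫ glueDesc f g h = g := pushout.inr_desc _ _ _

lemma glue_cases {x : Baseᵒᵖ} (e : (glue m n a c).obj x) :
    (∃ y, (glueInl a c).app x y = e) ∨ ∃ y, (glueInr a c).app x y = e :=
  exists_or_of_isPushout (.of_hasPushout (select m a) (select n c)) x e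

/-- Channels of a glued position may be taken from the first agent, or else from the second one
when they are not among the glued ones. -/
lemma glue_channel_cases (e : Elem (glue m n a c) .star) :
    (∃ i, (glueInl a c).app _ (Edge.chan m i).hom = e) ∨
      ∃ j, (∀ k, j ≠ c k) ∧ (glueInr a c).app _ (Edge.chan n j).hom = e := by
  obtain ⟨y, rfl⟩ | ⟨y, rfl⟩ := glue_cases e
  · cases isNormal (x := .star) y
    exact .inl ⟨_, rfl⟩
  · cases isNormal (x := .star) y with | chan _ j =>
    by_cases hj : ∃ k, j = c k
    · obtain ⟨k, rfl⟩ := hj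
      exact .inl ⟨a k, by simpa using app_eq (glue_condition a c k) _ (𝟙 _)⟩
    · exact .inr ⟨j, by simpa using hj, rfl⟩

end

/-! ### Properties of seeds -/

lemma syncT_inl_app {n : ℕ} {a : Fin n} {m : ℕ} {c d : Fin m} {x : Vertex}
    (y : Base.of x ⟶ Base.of (.agent m)) :
    (syncT n a m c d).app (op (Base.of x)) ((glueInl ![c] ![a]).app _ y) =
      (y ≫ (Edge.t (.out m c d)).hom) ≫ (Edge.eps n a m c d).hom :=
  app_eq (glueInl_glueDesc ..) _ y

lemma syncT_inr_app {n : ℕ} {a : Fin n} {m : ℕ} {c d : Fin m} {x : Vertex}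
    (y : Base.of x ⟶ Base.of (.agent n)) :
    (syncT n a m c d).app (op (Base.of x)) ((glueInr ![c] ![a]).app _ y) =
      (y ≫ (Edge.t (.inp n a)).hom) ≫ (Edge.rho n a m c d).hom :=
  app_eq (glueInr_glueDesc ..) _ y

lemma syncS_inl_app {n : ℕ} {a : Fin n} {m : ℕ} {c d : Fin m} {x : Vertex}
    (y : Base.of x ⟶ Base.of (.agent m)) :
    (syncS n a m c d).app (op (Base.of x)) ((glueInl ![c, d] ![a.castSucc, Fin.last n]).app _ y) =
      (y ≫ (Edge.s (.out m c d)).hom) ≫ (Edge.eps n a m c d).hom :=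
  app_eq (glueInl_glueDesc ..) _ y

lemma syncS_inr_app {n : ℕ} {a : Fin n} {m : ℕ} {c d : Fin m} {x : Vertex}
    (y : Base.of x ⟶ Base.of (.agent (n + 1))) :
    (syncS n a m c d).app (op (Base.of x)) ((glueInr ![c, d] ![a.castSucc, Fin.last n]).app _ y) =
      (y ≫ (Edge.s (.inp n a)).hom) ≫ (Edge.rho n a m c d).hom :=
  app_eq (glueInr_glueDesc ..) _ y

lemma forkS_inl_app {n : ℕ} {x : Vertex} (y : Base.of x ⟶ Base.of (.agent n)) :
    (forkS n).app (op (Base.of x)) ((glueInl id id).app _ y) =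
      (y ≫ (Edge.s (.forkLeft n)).hom) ≫ (Edge.l n).hom :=
  app_eq (glueInl_glueDesc ..) _ y

lemma forkS_inr_app {n : ℕ} {x : Vertex} (y : Base.of x ⟶ Base.of (.agent n)) :
    (forkS n).app (op (Base.of x)) ((glueInr id id).app _ y) =
      (y ≫ (Edge.s (.forkRight n)).hom) ≫ (Edge.r n).hom :=
  app_eq (glueInr_glueDesc ..) _ y

lemma label_agent_comp_comp {k n : ℕ} {x y : Vertex} (φ : Base.of (.agent k) ⟶ Base.of (.agent n))
    (e : Edge (.agent n) x) (e' : Edge x y) :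
    label ((φ ≫ e.hom) ≫ e'.hom) = e'.label (e.label ()) := by
  rw [label_comp, label_comp]
  rfl

lemma mono_of_vertices {F G : Psh} (f : F ⟶ G)
    (h₀ : Function.Injective (f.app (op (Base.of .star))))
    (h₁ : ∀ k, Function.Injective (f.app (op (Base.of (.agent k)))))
    (h₂ : ∀ x : Vertex, 1 < x.dim → IsEmpty (Elem F x)) : Mono f := by
  refine (mono_iff f).2 fun ⟨⟨x⟩⟩ => ?_
  cases x with
  | star => exact h₀
  | agent k => exact h₁ k
  | basic v => exact fun e => (h₂ (.basic v) (by simp [Vertex.dim])).elim e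
  | fork n => exact fun e => (h₂ (.fork n) (by simp [Vertex.dim])).elim e
  | sync n a m c d => exact fun e => (h₂ (.sync n a m c d) (by simp [Vertex.dim])).elim e

lemma isFinalLeg_of_vertices {Y U : Psh} (s : Y ⟶ U)
    (h₀ : Function.Bijective (s.app (op (Base.of .star))))
    (h₁ : ∀ k, Function.Injective (s.app (op (Base.of (.agent k)))))
    (h₁' : ∀ k (e : Elem U (.agent k)), (∃ y, s.app _ y = e) ↔ ¬ Consumed U e)
    (h₂ : ∀ x : Vertex, 1 < x.dim → IsEmpty (Elem Y x)) : IsFinalLeg s where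
  mono := mono_of_vertices s h₀.1 h₁ h₂
  range_iff x e := by
    cases x with
    | star => exact ⟨fun _ => trivial, fun _ => h₀.2 e⟩
    | agent k => exact h₁' k e
    | basic v =>
      exact ⟨fun ⟨y, _⟩ => (h₂ (.basic v) (by simp [Vertex.dim])).elim y, fun h => h.elim⟩
    | fork n => exact ⟨fun ⟨y, _⟩ => (h₂ (.fork n) (by simp [Vertex.dim])).elim y, fun h => h.elim⟩
    | sync n a m c d =>
      exact ⟨fun ⟨y, _⟩ => (h₂ (.sync n a m c d) (by simp [Vertex.dim])).elim y, fun h => h.elim⟩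

lemma isEmpty_rep_agent {n : ℕ} {x : Vertex} (hx : 1 < x.dim) : IsEmpty (Elem (rep (.agent n)) x) :=
  hom_eq_empty hx

lemma isEmpty_glue {p m n : ℕ} {a : Fin p → Fin m} {c : Fin p → Fin n} {x : Vertex}
    (hx : 1 < x.dim) : IsEmpty (Elem (glue m n a c) x) := by
  refine ⟨fun e => ?_⟩
  obtain ⟨y, _⟩ | ⟨y, _⟩ := glue_cases e
  · exact (isEmpty_rep_agent hx).elim y
  · exact (isEmpty_rep_agent hx).elim y

lemma IsSeed.isEmpty_initial {Y M X : Psh} {s : Y ⟶ M} {t : X ⟶ M} (h : IsSeed s t) {x : Vertex}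
    (hx : 1 < x.dim) : IsEmpty (Elem X x) := by
  cases h
  · exact isEmpty_rep_agent hx
  · exact isEmpty_rep_agent hx
  · exact isEmpty_glue hx

lemma Basic.keep_injective {n n' : ℕ} (v : Basic n n') : Function.Injective v.keep :=
  Fin.castLE_injective _

lemma agent_hom_star_injective {n : ℕ} {x : Vertex} (φ : Base.of (.agent n) ⟶ Base.of x)
    (h : ∀ i j, channelName ((Edge.chan n i).hom ≫ φ) = channelName ((Edge.chan n j).hom ≫ φ) →
      i = j) :
    Function.Injective ((yoneda.map φ).app (op (Base.of .star))) := by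
  intro e e' he
  cases isNormal (x := .star) e with | chan _ i =>
  cases isNormal (x := .star) e' with | chan _ j =>
  rw [h i j (congrArg channelName he)]

lemma agent_hom_agent_injective {n k : ℕ} {x : Vertex} (φ : Base.of (.agent n) ⟶ Base.of x) :
    Function.Injective ((yoneda.map φ).app (op (Base.of (.agent k)))) := by
  intro e e' _
  exact label_injective (k := k) (x := .agent n) rfl

lemma IsSeed.mono_initial {Y M X : Psh} {s : Y ⟶ M} {t : X ⟶ M} (h : IsSeed s t) : Mono t := by
  refine mono_of_vertices t ?_ (fun k => ?_) fun x hx => h.isEmpty_initial hx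
  · cases h with
    | basic v =>
      refine agent_hom_star_injective _ fun i j h => ?_
      exact v.keep_injective h
    | fork n =>
      rw [forkT, Edge.map, Edge.map, ← Functor.map_comp]
      refine agent_hom_star_injective _ fun i j h => ?_
      exact h
    | sync n a m c d =>
      have hl : ∀ i, channelName ((syncT n a m c d).app (op (Base.of .star))
          ((glueInl ![c] ![a]).app _ (Edge.chan m i).hom)) = Sum.inl i := fun i => by
        rw [syncT_inl_app]; rfl
      have hr : ∀ j, j ≠ a → channelName ((syncT n a m c d).app (op (Base.of .star))
          ((glueInr ![c] ![a]).app _ (Edge.chan n j).hom)) = Sum.inr j := fun j hj => by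
        rw [syncT_inr_app]
        change Fin.lastCases (motive := fun _ => Fin m ⊕ Fin n) (.inl d) (receiverChannel a c)
          j.castSucc = Sum.inr j
        simp [receiverChannel, hj]
      intro e e' he
      have he' := congrArg channelName he
      obtain ⟨i, rfl⟩ | ⟨i, hi, rfl⟩ := glue_channel_cases e <;>
      obtain ⟨j, rfl⟩ | ⟨j, hj, rfl⟩ := glue_channel_cases e'
      · rw [hl, hl] at he'; cases he'; rfl
      · rw [hl, hr j (hj 0)] at he'; cases he'
      · rw [hr i (hi 0), hl] at he'; cases he'
      · rw [hr i (hi 0), hr j (hj 0)] at he'; cases he'; rfl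
  · cases h with
    | basic v => exact agent_hom_agent_injective _
    | fork n =>
      rw [forkT, Edge.map, Edge.map, ← Functor.map_comp]
      exact agent_hom_agent_injective _
    | sync n a m c d =>
      intro e e' he
      have he' := congrArg label he
      obtain ⟨y, rfl⟩ | ⟨y, rfl⟩ := glue_cases e <;> obtain ⟨z, rfl⟩ | ⟨z, rfl⟩ := glue_cases e'
      · rw [label_injective (k := k) (x := .agent m) (a₁ := y) (a₂ := z) rfl]
      · rw [syncT_inl_app, syncT_inr_app, label_agent_comp_comp,
          label_agent_comp_comp] at he'
        cases he'
      · rw [syncT_inl_app, syncT_inr_app, label_agent_comp_comp,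
          label_agent_comp_comp] at he'
        cases he'
      · rw [label_injective (k := k) (x := .agent n) (a₁ := y) (a₂ := z) rfl]

lemma IsSeed.isFinalLeg {Y M X : Psh} {s : Y ⟶ M} {t : X ⟶ M} (h : IsSeed s t) :
    IsFinalLeg s := by
  cases h with
  | basic v =>
    refine isFinalLeg_of_vertices _ ⟨agent_hom_star_injective _ fun i j h => h, fun e => ?_⟩
      (fun k => agent_hom_agent_injective _) (fun k e => ?_) fun x hx => isEmpty_rep_agent hx
    · cases isNormal (x := .star) e with | chan_s _ i => exact ⟨(Edge.chan _ i).hom, rfl⟩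
    · rw [consumed_rep_iff]
      constructor
      · rintro ⟨y, rfl⟩ hy
        cases isNormal (x := .agent k) y
        cases hy
      · intro h
        cases isNormal (x := .agent k) e with
        | t => exact (h rfl).elim
        | s => exact ⟨𝟙 (Base.of _), Category.id_comp (Edge.s v).hom⟩
  | fork n =>
    refine isFinalLeg_of_vertices _ ⟨?_, fun e => ?_⟩ (fun k => ?_) (fun k e => ?_)
      fun x hx => isEmpty_glue hx
    · intro e e' he
      have he' := congrArg channelName he
      obtain ⟨i, rfl⟩ | ⟨i, hi, -⟩ := glue_channel_cases e
      · obtain ⟨j, rfl⟩ | ⟨j, hj, -⟩ := glue_channel_cases e'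
        · rw [forkS_inl_app, forkS_inl_app] at he'
          rw [show i = j from he']
        · exact (hj j rfl).elim
      · exact (hi i rfl).elim
    · cases isNormal (x := .star) e with
      | chan_s_l _ i =>
        exact ⟨_, (forkS_inl_app (Edge.chan n i).hom).trans (Category.assoc _ _ _)⟩
    · intro e e' he
      have he' := congrArg label he
      obtain ⟨y, rfl⟩ | ⟨y, rfl⟩ := glue_cases e <;> obtain ⟨z, rfl⟩ | ⟨z, rfl⟩ := glue_cases e'
      · rw [label_injective (k := k) (x := .agent n) (a₁ := y) (a₂ := z) rfl]
      · rw [forkS_inl_app, forkS_inr_app, label_agent_comp_comp,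
          label_agent_comp_comp] at he'
        cases he'
      · rw [forkS_inl_app, forkS_inr_app, label_agent_comp_comp,
          label_agent_comp_comp] at he'
        cases he'
      · rw [label_injective (k := k) (x := .agent n) (a₁ := y) (a₂ := z) rfl]
    · rw [consumed_rep_iff]
      constructor
      · rintro ⟨y, rfl⟩ hy
        obtain ⟨y, rfl⟩ | ⟨y, rfl⟩ := glue_cases y
        · rw [forkS_inl_app, label_agent_comp_comp] at hy; cases hy
        · rw [forkS_inr_app, label_agent_comp_comp] at hy; cases hy
      · intro h
        cases isNormal (x := .agent k) e with
        | t_l => exact (h rfl).elim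
        | s_l => exact ⟨_, (forkS_inl_app (𝟙 _)).trans (by rw [Category.id_comp])⟩
        | s_r => exact ⟨_, (forkS_inr_app (𝟙 _)).trans (by rw [Category.id_comp])⟩
  | sync n a m c d =>
    refine isFinalLeg_of_vertices _ ⟨?_, fun e => ?_⟩ (fun k => ?_) (fun k e => ?_)
      fun x hx => isEmpty_glue hx
    · have hl : ∀ i, channelName ((syncS n a m c d).app (op (Base.of .star))
          ((glueInl ![c, d] ![a.castSucc, Fin.last n]).app _ (Edge.chan m i).hom)) = Sum.inl i :=
        fun i => by rw [syncS_inl_app]; rfl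
      have hr : ∀ j, (∀ k, j ≠ ![a.castSucc, Fin.last n] k) →
          ∃ j', j = j'.castSucc ∧ channelName ((syncS n a m c d).app (op (Base.of .star))
            ((glueInr ![c, d] ![a.castSucc, Fin.last n]).app _ (Edge.chan (n + 1) j).hom)) =
              Sum.inr j' := fun j hj => by
        induction j using Fin.lastCases with
        | last => exact (hj 1 rfl).elim
        | cast j =>
          refine ⟨j, rfl, ?_⟩
          have : j ≠ a := fun h => hj 0 (by rw [h]; rfl)
          rw [syncS_inr_app]
          change Fin.lastCases (motive := fun _ => Fin m ⊕ Fin n) (.inl d) (receiverChannel a c)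
            j.castSucc = Sum.inr j
          simp [receiverChannel, this]
      intro e e' he
      have he' := congrArg channelName he
      obtain ⟨i, rfl⟩ | ⟨i, hi, rfl⟩ := glue_channel_cases e <;>
      obtain ⟨j, rfl⟩ | ⟨j, hj, rfl⟩ := glue_channel_cases e'
      · rw [hl, hl] at he'; cases he'; rfl
      · obtain ⟨j', rfl, hj'⟩ := hr j hj
        rw [hl, hj'] at he'; cases he'
      · obtain ⟨i', rfl, hi'⟩ := hr i hi
        rw [hl, hi'] at he'; cases he'
      · obtain ⟨i', rfl, hi'⟩ := hr i hi
        obtain ⟨j', rfl, hj'⟩ := hr j hj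
        rw [hi', hj'] at he'; cases he'; rfl
    · cases isNormal (x := .star) e with
      | chan_s_eps _ _ _ _ _ i =>
        exact ⟨_, (syncS_inl_app (Edge.chan m i).hom).trans (Category.assoc _ _ _)⟩
      | chan_s_rho _ _ _ _ _ i =>
        exact ⟨_, (syncS_inr_app (Edge.chan (n + 1) i).hom).trans (Category.assoc _ _ _)⟩
    · intro e e' he
      have he' := congrArg label he
      obtain ⟨y, rfl⟩ | ⟨y, rfl⟩ := glue_cases e <;> obtain ⟨z, rfl⟩ | ⟨z, rfl⟩ := glue_cases e'
      · rw [label_injective (k := k) (x := .agent m) (a₁ := y) (a₂ := z) rfl]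
      · rw [syncS_inl_app, syncS_inr_app, label_agent_comp_comp,
          label_agent_comp_comp] at he'
        cases he'
      · rw [syncS_inl_app, syncS_inr_app, label_agent_comp_comp,
          label_agent_comp_comp] at he'
        cases he'
      · rw [label_injective (k := k) (x := .agent (n + 1)) (a₁ := y) (a₂ := z) rfl]
    · rw [consumed_rep_iff]
      constructor
      · rintro ⟨y, rfl⟩ hy
        obtain ⟨y, rfl⟩ | ⟨y, rfl⟩ := glue_cases y
        · rw [syncS_inl_app, label_agent_comp_comp] at hy; cases hy
        · rw [syncS_inr_app, label_agent_comp_comp] at hy; cases hy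
      · intro h
        cases isNormal (x := .agent k) e with
        | t_eps => exact (h rfl).elim
        | t_rho => exact (h rfl).elim
        | s_eps => exact ⟨_, (syncS_inl_app (𝟙 _)).trans (by rw [Category.id_comp])⟩
        | s_rho => exact ⟨_, (syncS_inr_app (𝟙 _)).trans (by rw [Category.id_comp])⟩

/-- The agents consumed in a seed are those of its initial position. -/
lemma IsSeed.consumed_iff {Y M X : Psh} {s : Y ⟶ M} {t : X ⟶ M} (h : IsSeed s t) {k : ℕ}
    (e : Elem M (.agent k)) : Consumed M e ↔ ∃ x, t.app _ x = e := by
  cases h with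
  | basic v =>
    rw [consumed_rep_iff]
    constructor
    · intro h
      cases isNormal (x := .agent k) e with
      | t => exact ⟨𝟙 (Base.of _), Category.id_comp (Edge.t v).hom⟩
      | s => cases h
    · rintro ⟨y, rfl⟩
      cases isNormal (x := .agent k) y
      rfl
  | fork n =>
    rw [consumed_rep_iff]
    constructor
    · intro h
      cases isNormal (x := .agent k) e with
      | t_l => exact ⟨𝟙 (Base.of _), by
          change (𝟙 _ ≫ (Edge.t (.forkLeft _)).hom) ≫ (Edge.l _).hom = _
          rw [Category.id_comp]⟩
      | s_l => cases h
      | s_r => cases h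
    · rintro ⟨y, rfl⟩
      cases isNormal (x := .agent k) y
      rfl
  | sync n a m c d =>
    rw [consumed_rep_iff]
    constructor
    · intro h
      cases isNormal (x := .agent k) e with
      | t_eps => exact ⟨_, (syncT_inl_app (𝟙 _)).trans (by rw [Category.id_comp])⟩
      | t_rho => exact ⟨_, (syncT_inr_app (𝟙 _)).trans (by rw [Category.id_comp])⟩
      | s_eps => cases h
      | s_rho => cases h
    · rintro ⟨y, rfl⟩
      obtain ⟨y, rfl⟩ | ⟨y, rfl⟩ := glue_cases y
      · rw [syncT_inl_app, label_agent_comp_comp]; rfl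
      · rw [syncT_inr_app, label_agent_comp_comp]; rfl

/-! ### Finiteness -/

lemma IsFinite.of_mono {F G : Psh} (f : F ⟶ G) [Mono f] (h : IsFinite G) : IsFinite F := by
  have : Finite (Σ c : Base, G.obj (op c)) := h
  refine Finite.of_injective (β := Σ c : Base, G.obj (op c))
    (Sigma.map _root_.id fun c => f.app (op c)) ?_
  exact Function.injective_id.sigma_map fun c => app_injective f (op c)

lemma IsFinite.of_isPushout {A B C D : Psh} {f : A ⟶ B} {g : A ⟶ C} {i : B ⟶ D} {j : C ⟶ D}
    (h : IsPushout f g i j) (hB : IsFinite B) (hC : IsFinite C) : IsFinite D := by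
  have : Finite (Σ c : Base, B.obj (op c)) := hB
  have : Finite (Σ c : Base, C.obj (op c)) := hC
  refine Finite.of_surjective (α := (Σ c : Base, B.obj (op c)) ⊕ (Σ c : Base, C.obj (op c)))
    (Sum.elim (Sigma.map _root_.id fun c => i.app (op c))
      (Sigma.map _root_.id fun c => j.app (op c))) ?_
  rintro ⟨c, x⟩
  obtain ⟨y, rfl⟩ | ⟨y, rfl⟩ := exists_or_of_isPushout h (op c) x
  · exact ⟨.inl ⟨c, y⟩, rfl⟩
  · exact ⟨.inr ⟨c, y⟩, rfl⟩

lemma isFinite_rep (x : Vertex) : IsFinite (rep x) := by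
  suffices h : ∃ S : Set (Σ c : Base, (c ⟶ Base.of x)), S.Finite ∧
      ∀ (y : Vertex) (φ : Base.of y ⟶ Base.of x), ⟨Base.of y, φ⟩ ∈ S by
    obtain ⟨S, hS, hS'⟩ := h
    exact Set.finite_univ_iff.1 (hS.subset fun e _ => hS' e.1.as e.2)
  cases x with
  | star =>
    refine ⟨{⟨_, 𝟙 _⟩}, Set.toFinite _, fun y φ => ?_⟩
    cases isNormal φ
    rfl
  | agent n =>
    refine ⟨{⟨_, 𝟙 _⟩} ∪ Set.range fun i => ⟨_, (Edge.chan n i).hom⟩, Set.toFinite _,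
      fun y φ => ?_⟩
    cases isNormal φ with
    | id => exact .inl rfl
    | chan _ i => exact .inr ⟨i, rfl⟩
  | basic v =>
    refine ⟨{⟨_, 𝟙 _⟩, ⟨_, (Edge.t v).hom⟩, ⟨_, (Edge.s v).hom⟩} ∪
      Set.range fun i => ⟨_, (Edge.chan _ i).hom ≫ (Edge.s v).hom⟩, Set.toFinite _, fun y φ => ?_⟩
    cases isNormal φ with
    | id => exact .inl (.inl rfl)
    | t => exact .inl (.inr (.inl rfl))
    | s => exact .inl (.inr (.inr rfl))
    | chan_s _ i => exact .inr ⟨i, rfl⟩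
  | fork n =>
    refine ⟨{⟨_, 𝟙 _⟩, ⟨_, (Edge.l n).hom⟩, ⟨_, (Edge.r n).hom⟩,
      ⟨_, (Edge.t (.forkLeft n)).hom ≫ (Edge.l n).hom⟩,
      ⟨_, (Edge.s (.forkLeft n)).hom ≫ (Edge.l n).hom⟩,
      ⟨_, (Edge.s (.forkRight n)).hom ≫ (Edge.r n).hom⟩} ∪
      Set.range fun i => ⟨_, (Edge.chan n i).hom ≫ (Edge.s (.forkLeft n)).hom ≫ (Edge.l n).hom⟩,
      Set.toFinite _, fun y φ => ?_⟩
    cases isNormal φ with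
    | chan_s_l _ i => exact .inr ⟨i, rfl⟩
    | _ => exact .inl (by simp)
  | sync n a m c d =>
    refine ⟨{⟨_, 𝟙 _⟩, ⟨_, (Edge.rho n a m c d).hom⟩, ⟨_, (Edge.eps n a m c d).hom⟩,
      ⟨_, (Edge.t (.inp n a)).hom ≫ (Edge.rho n a m c d).hom⟩,
      ⟨_, (Edge.s (.inp n a)).hom ≫ (Edge.rho n a m c d).hom⟩,
      ⟨_, (Edge.t (.out m c d)).hom ≫ (Edge.eps n a m c d).hom⟩,
      ⟨_, (Edge.s (.out m c d)).hom ≫ (Edge.eps n a m c d).hom⟩} ∪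
      (Set.range fun i => ⟨_, (Edge.chan (n + 1) i).hom ≫ (Edge.s (.inp n a)).hom ≫
        (Edge.rho n a m c d).hom⟩) ∪
      Set.range fun i => ⟨_, (Edge.chan m i).hom ≫ (Edge.s (.out m c d)).hom ≫
        (Edge.eps n a m c d).hom⟩,
      Set.toFinite _, fun y φ => ?_⟩
    cases isNormal φ with
    | chan_s_rho _ _ _ _ _ i => exact .inl (.inr ⟨i, rfl⟩)
    | chan_s_eps _ _ _ _ _ i => exact .inr ⟨i, rfl⟩
    | _ => exact .inl (.inl (by simp))

/-! ### Maps out of seeds -/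

lemma IsSeed.exists_rep {Y M X : Psh} {s : Y ⟶ M} {t : X ⟶ M} (h : IsSeed s t) :
    ∃ x : Vertex, 1 < x.dim ∧ M = rep x := by
  cases h
  · exact ⟨_, by simp [Vertex.dim], rfl⟩
  · exact ⟨_, by simp [Vertex.dim], rfl⟩
  · exact ⟨_, by simp [Vertex.dim], rfl⟩

lemma IsSeed.isFinite {Y M X : Psh} {s : Y ⟶ M} {t : X ⟶ M} (h : IsSeed s t) : IsFinite M := by
  obtain ⟨x, -, rfl⟩ := h.exists_rep
  exact isFinite_rep x

lemma rep_hom_ext {x : Vertex} {F : Psh} {f g : rep x ⟶ F}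
    (h : f.app (op (Base.of x)) (𝟙 _) = g.app (op (Base.of x)) (𝟙 _)) : f = g :=
  yonedaEquiv.injective h

lemma exists_rep_hom {x : Vertex} {F : Psh} (e : Elem F x) :
    ∃ f : rep x ⟶ F, f.app (op (Base.of x)) (𝟙 _) = e :=
  ⟨yonedaEquiv.symm e, yonedaEquiv.apply_symm_apply e⟩

lemma rep_hom_factors {A B C D : Psh} {f : A ⟶ B} {g : A ⟶ C} {i : B ⟶ D} {j : C ⟶ D}
    (h : IsPushout f g i j) {x : Vertex} (v : rep x ⟶ D) :
    (∃ w, w ≫ i = v) ∨ ∃ w, w ≫ j = v := by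
  obtain ⟨y, hy⟩ | ⟨y, hy⟩ := exists_or_of_isPushout h _ (v.app (op (Base.of x)) (𝟙 _))
  · obtain ⟨w, rfl⟩ := exists_rep_hom y
    exact .inl ⟨w, rep_hom_ext hy⟩
  · obtain ⟨w, rfl⟩ := exists_rep_hom y
    exact .inr ⟨w, rep_hom_ext hy⟩

lemma OneInjective.injective {F G : Psh} {f : F ⟶ G} (h : OneInjective f) {x : Vertex}
    (hx : 0 < x.dim) : Function.Injective (f.app (op (Base.of x))) := h (Base.of x) hx

lemma OneInjective.of_mono {F G : Psh} (f : F ⟶ G) [Mono f] : OneInjective f :=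
  fun _ _ => app_injective f _

lemma OneInjective.of_comp {F G K : Psh} {f : F ⟶ G} {g : G ⟶ K} (h : OneInjective (f ≫ g)) :
    OneInjective f := fun c hc => Function.Injective.of_comp (h c hc)

lemma rep_hom_ext_of_oneInjective {x : Vertex} (hx : 0 < x.dim) {F G : Psh} {f : F ⟶ G}
    (hf : OneInjective f) {a b : rep x ⟶ F} (h : a ≫ f = b ≫ f) : a = b :=
  rep_hom_ext (hf.injective hx (app_eq h _ _))

lemma agent_dim_pos {n : ℕ} : 0 < (Vertex.agent n).dim := Nat.one_pos

/-- The initial position of a seed is generated by its agents. -/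
lemma IsSeed.exists_agent {Y M X : Psh} {s : Y ⟶ M} {t : X ⟶ M} (h : IsSeed s t)
    (e : Elem X .star) : ∃ (k : ℕ) (q : Elem X (.agent k)) (i : Fin k),
      X.map (Edge.chan k i).hom.op q = e := by
  have key : ∀ {n : ℕ} (y : Base.of .star ⟶ Base.of (.agent n)),
      ∃ i, y = (Edge.chan n i).hom := fun {n} y => by
    cases isNormal (x := .star) y with | chan _ i => exact ⟨i, rfl⟩
  have key' : ∀ {n : ℕ} (f : rep (.agent n) ⟶ X) (y : Elem (rep (.agent n)) .star),
      ∃ (k : ℕ) (q : Elem X (.agent k)) (i : Fin k),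
        X.map (Edge.chan k i).hom.op q = f.app _ y := fun {n} f y => by
    obtain ⟨i, rfl⟩ := key y
    refine ⟨n, f.app _ (𝟙 (Base.of (.agent n))), i, ?_⟩
    rw [← app_map]
    exact congrArg (f.app _) (Category.comp_id (Edge.chan n i).hom)
  cases h with
  | basic v => exact key' (𝟙 _) e
  | fork n => exact key' (𝟙 _) e
  | sync n a m c d =>
    obtain ⟨y, rfl⟩ | ⟨y, rfl⟩ := glue_cases e
    · exact key' _ y
    · exact key' _ y

lemma IsSeed.exists_lift {Y M X : Psh} {s : Y ⟶ M} {t : X ⟶ M} (h : IsSeed s t) {F G : Psh}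
    (i : F ⟶ G) [Mono i] (u : X ⟶ G)
    (hu : ∀ k (e : Elem X (.agent k)), ∃ y, i.app _ y = u.app _ e) : ∃ g : X ⟶ F, g ≫ i = u := by
  refine PiTraces.exists_lift i u ?_
  intro x e
  cases x with
  | star =>
    obtain ⟨k, q, j, rfl⟩ := h.exists_agent e
    obtain ⟨y, hy⟩ := hu k q
    refine ⟨F.map (Edge.chan k j).hom.op y, ?_⟩
    rw [app_map, app_map, hy]
  | agent k => exact hu k e
  | basic v => exact (h.isEmpty_initial (x := .basic v) (by simp [Vertex.dim])).elim e
  | fork n => exact (h.isEmpty_initial (x := .fork n) (by simp [Vertex.dim])).elim e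
  | sync n a m c d =>
    exact (h.isEmpty_initial (x := .sync n a m c d) (by simp [Vertex.dim])).elim e

lemma IsSeed.hom_ext {Y M X : Psh} {s : Y ⟶ M} {t : X ⟶ M} (h : IsSeed s t) {F G : Psh}
    {f : F ⟶ G} (hf : OneInjective f) {a b : X ⟶ F} (hab : a ≫ f = b ≫ f) : a = b := by
  have hk : ∀ k (q : Elem X (.agent k)), a.app _ q = b.app _ q := fun k q =>
    hf.injective agent_dim_pos (app_eq hab _ q)
  refine hom_ext_of_vertices fun x e => ?_
  cases x with
  | star =>
    obtain ⟨k, q, j, rfl⟩ := h.exists_agent e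
    rw [app_map, app_map, hk]
  | agent k => exact hk k e
  | basic v => exact (h.isEmpty_initial (x := .basic v) (by simp [Vertex.dim])).elim e
  | fork n => exact (h.isEmpty_initial (x := .fork n) (by simp [Vertex.dim])).elim e
  | sync n a m c d =>
    exact (h.isEmpty_initial (x := .sync n a m c d) (by simp [Vertex.dim])).elim e

/-- Along `1`-injective maps, the fillers in the definition of `H` are unique, and one of the two
triangles suffices. -/
lemma H_of_oneInjective {C D : Psh} {f : C ⟶ D} (hf : OneInjective f)
    (h : ∀ {Y M X : Psh} {s : Y ⟶ M} {t : X ⟶ M}, IsSeed s t → ∀ (u : X ⟶ C) (v : M ⟶ D),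
      u ≫ f = t ≫ v → ∃ k : M ⟶ C, k ≫ f = v) : H f := by
  rintro X M t ⟨Y, s, hs⟩ u v w
  obtain ⟨k, hk⟩ := h hs u v w
  refine ⟨k, ⟨hs.hom_ext hf (by rw [Category.assoc, hk, w]), hk⟩, fun k' hk' => ?_⟩
  obtain ⟨x, hx, rfl⟩ := hs.exists_rep
  exact rep_hom_ext_of_oneInjective (by lia) hf (by rw [hk, hk'.2])

lemma IsSeed.isEmpty_hom {Y M X : Psh} {s : Y ⟶ M} {t : X ⟶ M} (h : IsSeed s t) {F : Psh}
    (hF : ∀ x : Vertex, 1 < x.dim → IsEmpty (Elem F x)) : IsEmpty (M ⟶ F) := by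
  obtain ⟨x, hx, rfl⟩ := h.exists_rep
  exact ⟨fun v => (hF x hx).elim (v.app (op (Base.of x)) (𝟙 _))⟩

/-- The agent of a shape of dimension `2` takes part in every action occurring in it. -/
lemma IsSeed.exists_factor_basic {Y M X : Psh} {s : Y ⟶ M} {t : X ⟶ M} (h : IsSeed s t)
    {n n' : ℕ} (v : Basic n n') (e : M ⟶ rep (.basic v)) :
    ∃ i : rep (.agent n) ⟶ X, i ≫ t ≫ e = (Edge.t v).map := by
  cases h with
  | basic w =>
    obtain ⟨φ, rfl⟩ := yoneda.map_surjective e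
    cases isNormal φ
    exact ⟨𝟙 _, by simp⟩
  | fork n =>
    obtain ⟨φ, rfl⟩ := yoneda.map_surjective e
    exact (hom_eq_empty (by simp [Vertex.dim])).elim φ
  | sync n a m c d =>
    obtain ⟨φ, rfl⟩ := yoneda.map_surjective e
    exact (hom_eq_empty (by simp [Vertex.dim])).elim φ

/-- The agent of a fork takes part in every action occurring in it, which may be a half. -/
lemma IsSeed.exists_factor_fork {Y M X : Psh} {s : Y ⟶ M} {t : X ⟶ M} (h : IsSeed s t)
    {n : ℕ} (e : M ⟶ rep (.fork n)) : ∃ i : rep (.agent n) ⟶ X, i ≫ t ≫ e = forkT n := by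
  cases h with
  | basic w =>
    obtain ⟨φ, rfl⟩ := yoneda.map_surjective e
    cases isNormal φ with
    | l => exact ⟨𝟙 _, by simp [forkT]⟩
    | r => exact ⟨𝟙 _, by simp [forkT, fork_eq]⟩
  | fork m =>
    obtain ⟨φ, rfl⟩ := yoneda.map_surjective e
    cases isNormal φ
    exact ⟨𝟙 _, by simp⟩
  | sync n a m c d =>
    obtain ⟨φ, rfl⟩ := yoneda.map_surjective e
    exact (hom_eq_empty (by simp [Vertex.dim])).elim φ

/-! ### Interfaces -/

lemma exists_interface_elem (F : Psh) {x : Vertex} (e : Elem (interface F) x) :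
    ∃ (q : Elem F .star) (φ : Base.of x ⟶ Base.of .star),
      (Sigma.ι (fun _ : Elem F .star => rep .star) q).app _ φ = e := by
  obtain ⟨⟨q⟩, φ, rfl⟩ := FunctorToTypes.jointly_surjective' _ _ e
  exact ⟨q, φ, rfl⟩

lemma ι_interfaceMap_app (F : Psh) (q : Elem F .star) :
    (interfaceMap F).app _ ((Sigma.ι (fun _ : Elem F .star => rep .star) q).app _
      (𝟙 (Base.of .star))) = q := by
  have : Sigma.ι (fun _ : Elem F .star => rep .star) q ≫ interfaceMap F = yonedaEquiv.symm q :=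
    Sigma.ι_desc _ _
  refine (app_eq this _ (𝟙 (Base.of .star))).trans ?_
  exact yonedaEquiv.apply_symm_apply q

lemma isEmpty_interface (F : Psh) {x : Vertex} (hx : 0 < x.dim) :
    IsEmpty (Elem (interface F) x) := by
  refine ⟨fun e => ?_⟩
  obtain ⟨q, φ, -⟩ := exists_interface_elem F e
  exact (hom_eq_empty (y := .star) hx).elim φ

lemma interfaceMap_surjective (F : Psh) (q : Elem F .star) : ∃ e, (interfaceMap F).app _ e = q :=
  ⟨_, ι_interfaceMap_app F q⟩

instance (F : Psh) : Mono (interfaceMap F) := by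
  refine (mono_iff _).2 fun ⟨⟨x⟩⟩ e e' h => ?_
  by_cases hx : 0 < Vertex.dim x
  · exact (isEmpty_interface F hx).elim e
  · change Vertex at x
    cases x with
    | star =>
      obtain ⟨q, φ, rfl⟩ := exists_interface_elem (x := .star) F e
      obtain ⟨q', φ', rfl⟩ := exists_interface_elem (x := .star) F e'
      cases isNormal (x := .star) φ
      cases isNormal (x := .star) φ'
      have : q = q' := (ι_interfaceMap_app F q).symm.trans (h.trans (ι_interfaceMap_app F q'))
      rw [this]
    | _ => simp [Vertex.dim] at hx

/-! ### Actions -/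

section

variable {Y₀ M₀ X₀ X M : Psh} {s₀ : Y₀ ⟶ M₀} {t₀ : X₀ ⟶ M₀} {x : X₀ ⟶ X} {m : M₀ ⟶ M} {t : X ⟶ M}

lemma IsSeed.consumed_iff_of_isPushout (hS : IsSeed s₀ t₀) (h : IsPushout t₀ x m t)
    (hX : ∀ c : Vertex, 1 < c.dim → IsEmpty (Elem X c)) {k : ℕ} (e : Elem M (.agent k)) :
    Consumed M e ↔ ∃ q, m.app _ (t₀.app _ q) = e := by
  constructor
  · rintro ⟨k', v, w, rfl⟩
    obtain ⟨w, rfl⟩ | ⟨w, -⟩ := exists_or_of_isPushout h _ w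
    · obtain ⟨q, hq⟩ := (hS.consumed_iff _).1 ⟨k', v, w, rfl⟩
      exact ⟨q, by rw [hq, app_map]⟩
    · exact (hX (.basic v) (by simp [Vertex.dim])).elim w
  · rintro ⟨q, rfl⟩
    exact ((hS.consumed_iff _).2 ⟨q, rfl⟩).map m

end

/-- What an action looks like: a seed glued along its initial position, leading to the final
position of the result. -/
structure IsGluing {Y M X Y₀ M₀ X₀ : Psh} (s : Y ⟶ M) (t : X ⟶ M) (s₀ : Y₀ ⟶ M₀) (t₀ : X₀ ⟶ M₀)
    (x : X₀ ⟶ X) (m : M₀ ⟶ M) : Prop where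
  isSeed : IsSeed s₀ t₀
  isPosition : IsPosition X
  oneInjective : OneInjective x
  isPushout : IsPushout t₀ x m t
  isFinalLeg : IsFinalLeg s

lemma IsPosition.isEmpty {F : Psh} (h : IsPosition F) {x : Vertex} (hx : 1 < x.dim) :
    IsEmpty (Elem F x) := h.2 (Base.of x) hx

lemma IsAction.exists_isGluing {Y M X : Psh} {s : Y ⟶ M} {t : X ⟶ M} (h : IsAction s t) :
    ∃ (Y₀ M₀ X₀ : Psh) (s₀ : Y₀ ⟶ M₀) (t₀ : X₀ ⟶ M₀) (x : X₀ ⟶ X) (m : M₀ ⟶ M),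
      IsGluing s t s₀ t₀ x m := by
  obtain ⟨Y₀, M₀, X₀, s₀, t₀, j, Z, z, y, m, x, zY, zM, zX, hS, hj, hZ, hY, hM, hX,
    e₁, e₂, e₃, e₄⟩ := h
  have ht : IsPushout t₀ x m t := (IsPushout.of_top (e₄ ▸ hM.flip) e₃ hX.flip).flip
  have hs : IsPushout s₀ y m s :=
    (IsPushout.of_top (by rw [hj, e₂]; exact hM.flip) e₁ hY.flip).flip
  have := hS.mono_initial
  have := hS.isFinalLeg.mono
  have hX' : ∀ c : Vertex, 1 < c.dim → IsEmpty (Elem X c) := fun c hc => ⟨fun e => by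
    obtain ⟨q, -⟩ | ⟨q, -⟩ := exists_or_of_isPushout hX _ e
    · exact (hS.isEmpty_initial hc).elim q
    · exact (hZ.isEmpty hc).elim q⟩
  have hmono : Mono s := mono_of_isPushout hs
  refine ⟨Y₀, M₀, X₀, s₀, t₀, x, m, hS, ⟨.of_isPushout hX (.of_mono t₀ hS.isFinite) hZ.1,
    fun c => hX' c.as⟩, fun c hc q q' hq => ?_, ht, ?_⟩
  · obtain h | ⟨a, -⟩ := eq_or_exists_of_isPushout hX hq
    · exact h
    · exact (isEmpty_interface X₀ hc).elim a
  · refine isFinalLeg_of_vertices s ⟨app_injective s _, fun e => ?_⟩ (fun k => app_injective s _)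
      (fun k e => ⟨?_, fun he => ?_⟩) fun c hc => ⟨fun e => ?_⟩
    · obtain ⟨q, rfl⟩ | h := exists_or_of_isPushout hs _ e
      · obtain ⟨q, rfl⟩ := hS.isFinalLeg.exists_star q
        exact ⟨y.app _ q, app_eq e₁ _ q⟩
      · exact h
    · rintro ⟨e, rfl⟩ he
      obtain ⟨q, hq⟩ := (hS.consumed_iff_of_isPushout ht hX' _).1 he
      obtain ⟨a, ha, -⟩ := exists_of_isPushout_of_eq hs hq
      exact hS.isFinalLeg.not_consumed a (ha ▸ (hS.consumed_iff _).2 ⟨q, rfl⟩)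
    · obtain ⟨q, rfl⟩ | h := exists_or_of_isPushout hs _ e
      · obtain ⟨q, rfl⟩ := hS.isFinalLeg.exists_agent fun h => he (h.map m)
        exact ⟨y.app _ q, app_eq e₁ _ q⟩
      · exact h
    · obtain ⟨q, -⟩ | ⟨q, -⟩ := exists_or_of_isPushout hY _ e
      · exact (hS.isFinalLeg.isEmpty hc).elim q
      · exact (hZ.isEmpty hc).elim q

/-- Gluing a seed yields an action: what the seed is pushed along is obtained by removing the
acting agents from the initial position, that is, by intersecting it with the final one. -/
lemma IsGluing.isAction {Y M X Y₀ M₀ X₀ : Psh} {s : Y ⟶ M} {t : X ⟶ M} {s₀ : Y₀ ⟶ M₀}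
    {t₀ : X₀ ⟶ M₀} {x : X₀ ⟶ X} {m : M₀ ⟶ M} (h : IsGluing s t s₀ t₀ x m) : IsAction s t := by
  obtain ⟨hS, hX, hx, ht, hs⟩ := h
  have := hS.mono_initial
  have := hS.isFinalLeg.mono
  have := hs.mono
  have : Mono t := mono_of_isPushout ht
  obtain ⟨j, hj⟩ := exists_lift s₀ (interfaceMap X₀ ≫ t₀) fun c e => by
    by_cases hc : 0 < c.dim
    · exact (isEmpty_interface X₀ hc).elim e
    · cases c with
      | star => exact hS.isFinalLeg.exists_star _
      | _ => simp [Vertex.dim] at hc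
  have hcons := fun {k : ℕ} => hS.consumed_iff_of_isPushout ht (fun c hc => hX.isEmpty hc) (k := k)
  obtain ⟨y, hy⟩ := exists_lift s (s₀ ≫ m) fun c e => by
    cases c with
    | star => exact hs.exists_star _
    | agent k =>
      refine hs.exists_agent fun he => ?_
      obtain ⟨q, hq⟩ := (hcons _).1 he
      obtain h | ⟨a, ha⟩ := eq_or_exists_of_isPushout ht (hq.symm : m.app _ (s₀.app _ e) = _)
      · exact hS.isFinalLeg.not_consumed e ((hS.consumed_iff _).2 ⟨q, h.symm⟩)
      · exact hS.isFinalLeg.not_consumed e ((hS.consumed_iff _).2 ⟨a, ha⟩)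
    | _ => exact (hS.isFinalLeg.isEmpty (by simp [Vertex.dim])).elim e
  have hz : (interfaceMap X₀ ≫ x) ≫ t = (j ≫ y) ≫ s := by
    rw [Category.assoc, Category.assoc, hy, reassoc_of% hj, ht.w]
  let z : interface X₀ ⟶ pullback t s := pullback.lift _ _ hz
  have hz₁ : z ≫ pullback.fst t s = interfaceMap X₀ ≫ x := pullback.lift_fst _ _ _
  have hz₂ : z ≫ pullback.snd t s = j ≫ y := pullback.lift_snd _ _ _
  have hst : ∀ {c : Vertex} (ζ : Elem (pullback t s) c),
      t.app _ ((pullback.fst t s).app _ ζ) = s.app _ ((pullback.snd t s).app _ ζ) :=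
    fun ζ => app_eq pullback.condition _ ζ
  have hts : ∀ {c : Vertex} (p : Elem X c) (q : Elem Y c), s.app _ q = t.app _ p →
      ∃ ζ, (pullback.fst t s).app _ ζ = p := fun p q h => by
    obtain ⟨ζ, hζ, -⟩ := exists_of_isPullback (.of_hasPullback t s) h.symm
    exact ⟨ζ, hζ⟩
  -- The three pushout squares are checked on elements. The intersection contains all channels of
  -- `X` and all its agents that do not act.
  have hM : IsPushout (interfaceMap X₀ ≫ t₀) z m (pullback.fst t s ≫ t) := by
    refine isPushout_of_elements ?_ (fun c e => ?_) (fun c b b' e => ?_) (fun c b b' e => ?_)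
    · rw [reassoc_of% hz₁, Category.assoc, ht.w]
    · obtain h | ⟨p, rfl⟩ := exists_or_of_isPushout ht _ e
      · exact .inl h
      · cases c with
        | star =>
          obtain ⟨q, hq⟩ := hs.exists_star (t.app _ p)
          obtain ⟨ζ, rfl⟩ := hts p q hq
          exact .inr ⟨ζ, rfl⟩
        | agent k =>
          by_cases hc : Consumed M (t.app _ p)
          · obtain ⟨q, hq⟩ := (hcons _).1 hc
            exact .inl ⟨_, hq⟩
          · obtain ⟨q, hq⟩ := hs.exists_agent hc
            obtain ⟨ζ, rfl⟩ := hts p q hq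
            exact .inr ⟨ζ, rfl⟩
        | _ => exact (hX.isEmpty (by simp [Vertex.dim])).elim p
    · obtain ⟨a, rfl, ha⟩ := exists_of_isPushout_of_eq ht e
      cases c with
      | star =>
        obtain ⟨a, rfl⟩ := interfaceMap_surjective X₀ a
        exact ⟨a, rfl⟩
      | agent k =>
        refine (hs.not_consumed ((pullback.snd t s).app _ b') ?_).elim
        rw [← hst]
        exact (hcons _).2 ⟨a, (app_eq ht.w _ a).trans (congrArg (t.app _) ha)⟩
      | _ => exact (hS.isEmpty_initial (by simp [Vertex.dim])).elim a
    · obtain h | ⟨a, ha⟩ := eq_or_exists_of_isPushout ht e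
      · exact .inl h
      · obtain h | ⟨a', ha'⟩ := eq_or_exists_of_isPushout ht e.symm
        · exact .inl h.symm
        · cases c with
          | star =>
            obtain ⟨a, rfl⟩ := interfaceMap_surjective X₀ a
            exact .inr ⟨a, ha⟩
          | agent k =>
            subst ha ha'
            have h : t.app _ (x.app _ a) = t.app _ (x.app _ a') :=
              (app_eq ht.w _ a).symm.trans (e.trans (app_eq ht.w _ a'))
            rw [hx.injective agent_dim_pos (app_injective t _ h)]
            exact .inl rfl
          | _ => exact (hS.isEmpty_initial (by simp [Vertex.dim])).elim a
  have : Mono (j ≫ s₀) := by rw [hj]; infer_instance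
  have : Mono j := mono_of_mono j s₀
  have hm₁ : ∀ {c} (b : Y₀.obj c), s.app c (y.app c b) = m.app c (s₀.app c b) :=
    fun b => app_eq hy _ b
  have hm₂ : ∀ {c} (b : X₀.obj c), t.app c (x.app c b) = m.app c (t₀.app c b) :=
    fun b => app_eq ht.w.symm _ b
  refine ⟨Y₀, M₀, X₀, s₀, t₀, j, pullback t s, z, y, m, x, pullback.snd t s,
    pullback.fst t s ≫ t, pullback.fst t s, hS, hj, ⟨.of_mono (pullback.fst t s) hX.1,
      fun c hc => ⟨fun e => (hX.2 c hc).elim ((pullback.fst t s).app _ e)⟩⟩,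
    ?_, hM, ?_, hy, pullback.condition.symm, ht.w.symm, rfl⟩
  · refine isPushout_of_elements hz₂.symm (fun c e => ?_) (fun c b b' e => ?_) (fun c b b' e => ?_)
    · obtain ⟨q, hq⟩ | ⟨ζ, hζ⟩ := exists_or_of_isPushout hM _ (s.app _ e)
      · suffices h : ∃ q', s₀.app _ q' = q by
          obtain ⟨q', rfl⟩ := h
          exact .inl ⟨q', app_injective s _ ((hm₁ q').trans hq)⟩
        cases c with
        | star => exact hS.isFinalLeg.exists_star q
        | agent k =>
          exact hS.isFinalLeg.exists_agent fun h => hs.not_consumed e (hq ▸ h.map m)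
        | _ => exact (hs.isEmpty (by simp [Vertex.dim])).elim e
      · exact .inr ⟨ζ, app_injective s _ ((hst ζ).symm.trans hζ)⟩
    · obtain ⟨a, ha, -⟩ := exists_of_isPushout_of_eq hM
        (show m.app _ (s₀.app _ b) = (pullback.fst t s ≫ t).app _ b' by
          rw [← hm₁, e]; exact (hst b').symm)
      exact ⟨a, app_injective s₀ _ ((app_eq hj _ a).trans ha)⟩
    · obtain h | ⟨a, ha⟩ := eq_or_exists_of_isPushout hM
        (show m.app _ (s₀.app _ b) = m.app _ (s₀.app _ b') by rw [← hm₁, e, hm₁])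
      · exact .inl (app_injective s₀ _ h)
      · exact .inr ⟨a, app_injective s₀ _ ((app_eq hj _ a).trans ha)⟩
  · refine isPushout_of_elements hz₁.symm (fun c e => ?_) (fun c b b' e => ?_) (fun c b b' e => ?_)
    · cases c with
      | star =>
        obtain ⟨q, hq⟩ := hs.exists_star (t.app _ e)
        exact .inr (hts e q hq)
      | agent k =>
        by_cases hc : Consumed M (t.app _ e)
        · obtain ⟨q, hq⟩ := (hcons _).1 hc
          exact .inl ⟨q, app_injective t _ ((hm₂ q).trans hq)⟩
        · obtain ⟨q, hq⟩ := hs.exists_agent hc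
          exact .inr (hts e q hq)
      | _ => exact (hX.isEmpty (by simp [Vertex.dim])).elim e
    · obtain ⟨a, ha, -⟩ := exists_of_isPushout_of_eq hM
        (show m.app _ (t₀.app _ b) = (pullback.fst t s ≫ t).app _ b' by rw [← hm₂, e]; rfl)
      exact ⟨a, app_injective t₀ _ ha⟩
    · obtain h | ⟨a, ha⟩ := eq_or_exists_of_isPushout hM
        (show m.app _ (t₀.app _ b) = m.app _ (t₀.app _ b') by rw [← hm₂, e, hm₂])
      · exact .inl (app_injective t₀ _ h)
      · exact .inr ⟨a, app_injective t₀ _ ha⟩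

/-! ### Traces -/

lemma IsPosition.of_isIso {F G : Psh} (f : F ⟶ G) [IsIso f] (h : IsPosition G) : IsPosition F :=
  ⟨.of_mono f h.1, fun c hc => ⟨fun e => (h.2 c hc).elim (f.app _ e)⟩⟩

lemma IsFinalLeg.isPosition {Y U : Psh} {s : Y ⟶ U} (hs : IsFinalLeg s) (hU : IsFinite U) :
    IsPosition Y :=
  have := hs.mono
  ⟨.of_mono s hU, fun c hc => hs.isEmpty (x := c.as) hc⟩

lemma IsPosition.not_consumed {X : Psh} (h : IsPosition X) {k : ℕ} (e : Elem X (.agent k)) :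
    ¬ Consumed X e := by
  rintro ⟨k', v, w, -⟩
  exact (h.isEmpty (x := .basic v) (by simp [Vertex.dim])).elim w

lemma isFinalLeg_of_isIso {Y U : Psh} (s : Y ⟶ U) [IsIso s] (hU : IsPosition U) :
    IsFinalLeg s := by
  have hs : ∀ {c} (e : U.obj c), ∃ y, s.app c y = e := fun {c} e =>
    ⟨(inv s).app c e, app_eq (IsIso.inv_hom_id s) c e⟩
  exact isFinalLeg_of_vertices s ⟨app_injective s _, hs⟩ (fun k => app_injective s _)
    (fun k e => ⟨fun _ => hU.not_consumed e, fun _ => hs e⟩)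
    fun x hx => (IsPosition.of_isIso s hU).isEmpty hx

lemma IsFinalLeg.comp {Y V Z M U : Psh} {s₁ : Z ⟶ M} {s₂ : Y ⟶ V} {t₂ : Z ⟶ V} {m : M ⟶ U}
    {v : V ⟶ U} (h₁ : IsFinalLeg s₁) (h₂ : IsFinalLeg s₂) (h : IsPushout s₁ t₂ m v) :
    IsFinalLeg (s₂ ≫ v) := by
  have := h₁.mono
  have := h₂.mono
  have : Mono v := mono_of_isPushout h
  refine isFinalLeg_of_vertices _ ⟨app_injective _ _, fun e => ?_⟩ (fun k => app_injective _ _)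
    (fun k e => ⟨?_, fun he => ?_⟩) fun x hx => h₂.isEmpty hx
  · obtain ⟨q, rfl⟩ | ⟨q, rfl⟩ := exists_or_of_isPushout h _ e
    · obtain ⟨z, rfl⟩ := h₁.exists_star q
      obtain ⟨y, hy⟩ := h₂.exists_star (t₂.app _ z)
      exact ⟨y, (congrArg (v.app _) hy).trans (app_eq h.w _ z).symm⟩
    · obtain ⟨y, rfl⟩ := h₂.exists_star q
      exact ⟨y, rfl⟩
  · rintro ⟨y, rfl⟩ ⟨k', b, w, hw⟩
    obtain ⟨w, rfl⟩ | ⟨w, rfl⟩ := exists_or_of_isPushout h _ w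
    · rw [← app_map] at hw
      obtain ⟨z, hz, -⟩ := exists_of_isPushout_of_eq h (b' := s₂.app _ y) hw
      exact h₁.not_consumed z ⟨k', b, w, hz.symm⟩
    · rw [← app_map] at hw
      exact h₂.not_consumed y ⟨k', b, w, app_injective v _ hw⟩
  · obtain ⟨q, rfl⟩ | ⟨q, rfl⟩ := exists_or_of_isPushout h _ e
    · obtain ⟨z, rfl⟩ := h₁.exists_agent fun hq => he (hq.map m)
      have hz : m.app _ (s₁.app _ z) = v.app _ (t₂.app _ z) := app_eq h.w _ z
      rw [hz] at he ⊢
      obtain ⟨y, hy⟩ := h₂.exists_agent fun hq => he (hq.map v)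
      exact ⟨y, congrArg (v.app _) hy⟩
    · obtain ⟨y, rfl⟩ := h₂.exists_agent fun hq => he (hq.map v)
      exact ⟨y, rfl⟩

/-- The lower leg of a trace is monic and its upper one is the inclusion of the final position. -/
lemma IsTrace.properties {Y U X : Psh} {s : Y ⟶ U} {t : X ⟶ U} (h : IsTrace s t) :
    IsPosition X ∧ IsFinite U ∧ Mono t ∧ IsFinalLeg s := by
  induction h with
  | id s t hX hs ht =>
    have hU := hX.of_isIso (inv t)
    exact ⟨hX, hU.1, inferInstance, isFinalLeg_of_isIso s hU⟩
  | comp s₁ t₁ s₂ t₂ m v hM _ hU ih =>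
    obtain ⟨hZ, hVf, ht₂, hs₂⟩ := ih
    obtain ⟨Y₀, M₀, X₀, s₀, t₀, x, a, hS, hX, hx, ht₁, hs₁⟩ := hM.exists_isGluing
    have := hS.mono_initial
    have : Mono t₁ := mono_of_isPushout ht₁
    have : Mono m := mono_of_isPushout hU.flip
    exact ⟨hX, .of_isPushout hU (.of_isPushout ht₁ hS.isFinite hX.1) hVf, inferInstance,
      hs₁.comp hs₂ hU⟩

section

variable {Y U X : Psh} {s : Y ⟶ U} {t : X ⟶ U}

lemma IsTrace.isFinite (h : IsTrace s t) : IsFinite U := h.properties.2.1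

lemma IsTrace.mono (h : IsTrace s t) : Mono t := h.properties.2.2.1

lemma IsTrace.isFinalLeg (h : IsTrace s t) : IsFinalLeg s := h.properties.2.2.2

lemma IsTrace.isPosition_final (h : IsTrace s t) : IsPosition Y :=
  h.isFinalLeg.isPosition h.isFinite

lemma IsAction.iso_comp (h : IsAction s t) {X' : Psh} (c : X' ⟶ X) [IsIso c] :
    IsAction s (c ≫ t) := by
  obtain ⟨Y₀, M₀, X₀, s₀, t₀, j, Z, z, y, m, x, zY, zM, zX, hS, hj, hZ, hY, hM, hX,
    e₁, e₂, e₃, e₄⟩ := h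
  refine ⟨Y₀, M₀, X₀, s₀, t₀, j, Z, z, y, m, x ≫ inv c, zY, zM, zX ≫ inv c, hS, hj, hZ, hY, hM,
    ?_, e₁, e₂, by simpa using e₃, by simpa using e₄⟩
  exact hX.of_iso (.refl _) (.refl _) (.refl _) (asIso c).symm (by simp) (by simp) (by simp)
    (by simp)

lemma IsTrace.iso (h : IsTrace s t) : ∀ {Y' U' X' : Psh} (a : Y' ⟶ Y) (b : U ⟶ U') (c : X' ⟶ X)
    [IsIso a] [IsIso b] [IsIso c], IsTrace (a ≫ s ≫ b) (c ≫ t ≫ b) := by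
  induction h with
  | id s t hX hs ht =>
    intro Y' U' X' a b c _ _ _
    exact .id _ _ (hX.of_isIso c) inferInstance inferInstance
  | comp s₁ t₁ s₂ t₂ m v hM _ hU ih =>
    intro Y' U' X' a b c _ _ _
    have := IsTrace.comp (U := U') s₁ (c ≫ t₁) _ _ (m ≫ b) (v ≫ b) (hM.iso_comp c)
      (ih a (𝟙 _) (𝟙 _)) (hU.of_iso (.refl _) (.refl _) (.refl _) (asIso b) (by simp) (by simp)
        (by simp) (by simp))
    simpa using this

lemma IsTrace.of_action (h : IsAction s t) : IsTrace s t := by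
  obtain ⟨Y₀, M₀, X₀, s₀, t₀, x, a, hS, hX, hx, ht, hs⟩ := h.exists_isGluing
  have hY : IsPosition Y := hs.isPosition (.of_isPushout ht hS.isFinite hX.1)
  have := IsTrace.comp s t (𝟙 Y) (𝟙 Y) (𝟙 U) s h (.id _ _ hY inferInstance inferInstance)
    (IsPushout.of_vert_isIso ⟨by simp⟩)
  simpa using this

/-- Traces compose. -/
lemma IsTrace.trans (h : IsTrace s t) : ∀ {Y' V U' : Psh} {s' : Y' ⟶ V} {t' : Y ⟶ V}
    {m : U ⟶ U'} {v : V ⟶ U'}, IsTrace s' t' → IsPushout s t' m v → IsTrace (s' ≫ v) (t ≫ m) := by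
  induction h with
  | id s t hX hs ht =>
    intro Y' V U' s' t' m v h' hU
    have : IsIso v := hU.isIso_inr_of_isIso
    have hm : m = inv s ≫ t' ≫ v := by rw [IsIso.eq_inv_comp, hU.w]
    have := h'.iso (𝟙 _) v (t ≫ inv s)
    simpa [hm] using this
  | comp s₁ t₁ s₂ t₂ m v hM _ hU ih =>
    intro Y' W U' s' t' m' w h' hU'
    have hV := IsPushout.of_hasPushout s₂ t'
    obtain ⟨l, hl₁, hl₂⟩ : ∃ l, pushout.inl s₂ t' ≫ l = v ≫ m' ∧ pushout.inr s₂ t' ≫ l = w :=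
      ⟨hV.desc (v ≫ m') w (by simpa using hU'.w), hV.inl_desc .., hV.inr_desc ..⟩
    have h₁ : IsPushout v (pushout.inl s₂ t') m' l :=
      IsPushout.of_left (by rw [hl₂]; exact hU') hl₁.symm hV
    have := IsTrace.comp s₁ t₁ _ _ (m ≫ m') l hM (ih h' hV) (hU.paste_vert h₁)
    simpa [hl₂] using this

/-- A trace may be extended by an action of agents that it leaves unconsumed. -/
lemma IsTrace.exists_extension (h : IsTrace s t) {Y₀ M₀ X₀ : Psh} {s₀ : Y₀ ⟶ M₀} {t₀ : X₀ ⟶ M₀}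
    (hS : IsSeed s₀ t₀) (u : X₀ ⟶ U) (hu : OneInjective u)
    (hc : ∀ k (q : Elem X₀ (.agent k)), ¬ Consumed U (u.app _ q)) :
    ∃ (Y' U' : Psh) (s' : Y' ⟶ U') (w : M₀ ⟶ U') (k : U ⟶ U'),
      IsTrace s' (t ≫ k) ∧ IsPushout t₀ u w k := by
  have := h.isFinalLeg.mono
  obtain ⟨u, rfl⟩ := hS.exists_lift s u fun k e => h.isFinalLeg.exists_agent (hc k e)
  have h₁ := IsPushout.of_hasPushout t₀ u
  have ha : IsGluing (finalSubfunctor (pushout t₀ u)).ι (pushout.inr t₀ u) s₀ t₀ u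
      (pushout.inl t₀ u) :=
    ⟨hS, h.isPosition_final, .of_comp hu, h₁, isFinalLeg_finalSubfunctor _⟩
  have h₂ := IsPushout.of_hasPushout s (pushout.inr t₀ u)
  exact ⟨_, _, _, _, _, h.trans (.of_action ha.isAction) h₂, h₁.paste_vert h₂.flip⟩

end

/-! ### Restrictions of traces along maps of initial positions -/

lemma edge_map_comp_app_id {x y : Vertex} (e : Edge x y) {F : Psh} (v : rep y ⟶ F) :
    (e.map ≫ v).app (op (Base.of x)) (𝟙 (Base.of x)) =
      F.map e.hom.op (v.app (op (Base.of y)) (𝟙 (Base.of y))) :=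
  (yonedaEquiv_naturality v e.hom).symm

/-- Maps in `H` reflect consumed agents, since the seeds of dimension `2` lift along them. -/
lemma H.consumed {C D : Psh} {f : C ⟶ D} (hf : H f) {k : ℕ} {e : Elem C (.agent k)}
    (he : Consumed D (f.app _ e)) : Consumed C e := by
  obtain ⟨k', b, w, hw⟩ := he
  obtain ⟨u, rfl⟩ := exists_rep_hom e
  obtain ⟨v, rfl⟩ := exists_rep_hom w
  have huv : u ≫ f = (Edge.t b).map ≫ v := by
    exact rep_hom_ext (hw.symm.trans (edge_map_comp_app_id _ v).symm)
  obtain ⟨q, ⟨rfl, -⟩, -⟩ := hf _ ⟨_, _, .basic b⟩ u v huv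
  exact ⟨k', b, _, (edge_map_comp_app_id _ q).symm⟩

/-- A trace `s', t'` mapping to `U` over a map `h` of initial positions, `1`-injectively, and in
such a way that only agents of its initial position are mapped to agents of that of `U`. -/
structure IsPartialRestriction {X U X' Y' U' : Psh} (t : X ⟶ U) (h : X' ⟶ X) (s' : Y' ⟶ U')
    (t' : X' ⟶ U') (f : U' ⟶ U) : Prop where
  isTrace : IsTrace s' t'
  w : t' ≫ f = h ≫ t
  oneInjective : OneInjective f
  exists_initial {k : ℕ} (e : Elem U' (.agent k)) (p : Elem X (.agent k))
    (he : f.app _ e = t.app _ p) : ∃ q, t'.app _ q = e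

/-- A partial restriction to which no action can be added: whenever the agents of an action of `U`
lift, so does the action. -/
structure IsRestriction {X U X' Y' U' : Psh} (t : X ⟶ U) (h : X' ⟶ X) (s' : Y' ⟶ U')
    (t' : X' ⟶ U') (f : U' ⟶ U) : Prop extends IsPartialRestriction t h s' t' f where
  mem_H : H f

/-- The lower leg `t` admits restrictions along all `1`-injective maps of positions. -/
def HasRestrictions {X U : Psh} (t : X ⟶ U) : Prop :=
  ∀ ⦃X' : Psh⦄ (h : X' ⟶ X), IsPosition X' → OneInjective h →
    ∃ (Y' U' : Psh) (s' : Y' ⟶ U') (t' : X' ⟶ U') (f : U' ⟶ U), IsRestriction t h s' t' f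

/-- Maps in `H` restrict to final positions. -/
lemma IsFinalLeg.exists_map {Y U Y' U' : Psh} {s : Y ⟶ U} {s' : Y' ⟶ U'} (hs : IsFinalLeg s)
    (hs' : IsFinalLeg s') {f : U' ⟶ U} (hf : H f) : ∃ g : Y' ⟶ Y, g ≫ s = s' ≫ f := by
  have := hs.mono
  refine exists_lift s (s' ≫ f) fun x e => ?_
  cases x with
  | star => exact hs.exists_star _
  | agent k => exact hs.exists_agent fun he => hs'.not_consumed e (hf.consumed he)
  | _ => exact (hs'.isEmpty (by simp [Vertex.dim])).elim e

/-- Restrictions may be computed action by action. -/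
lemma HasRestrictions.comp {Y V Z M X U : Psh} {s₁ : Z ⟶ M} {t₁ : X ⟶ M} {s₂ : Y ⟶ V} {t₂ : Z ⟶ V}
    {m : M ⟶ U} {v : V ⟶ U} (h₁ : IsTrace s₁ t₁) (h₂ : IsTrace s₂ t₂) (hU : IsPushout s₁ t₂ m v)
    (H₁ : HasRestrictions t₁) (H₂ : HasRestrictions t₂) : HasRestrictions (t₁ ≫ m) := by
  intro X' h hX' hh
  obtain ⟨Z', M', s₁', t₁', f₁, hf₁⟩ := H₁ h hX' hh
  have hs₁ := h₁.isFinalLeg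
  have hs₁' := hf₁.isTrace.isFinalLeg
  have := hs₁.mono
  have := hs₁'.mono
  have := h₂.mono
  obtain ⟨g, hg⟩ := hs₁.exists_map hs₁' hf₁.mem_H
  have hg' : OneInjective g := .of_comp (g := s₁) (hg ▸ (OneInjective.of_mono s₁').comp
    hf₁.oneInjective)
  have hZ' : IsPosition Z' := hf₁.isTrace.isPosition_final
  obtain ⟨Y', V', s₂', t₂', f₂, hf₂⟩ := H₂ g hZ' hg'
  have := hf₂.isTrace.mono
  have : Mono v := mono_of_isPushout hU
  have : Mono m := mono_of_isPushout hU.flip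
  have hU' := IsPushout.of_hasPushout s₁' t₂'
  let i₁ := pushout.inl s₁' t₂'
  let i₂ := pushout.inr s₁' t₂'
  have : Mono i₂ := mono_of_isPushout hU'
  have : Mono i₁ := mono_of_isPushout hU'.flip
  have hi : ∀ {x : Vertex} (e : Elem Z' x), i₁.app _ (s₁'.app _ e) = i₂.app _ (t₂'.app _ e) :=
    fun e => app_eq hU'.w _ e
  obtain ⟨f, hi₁, hi₂⟩ : ∃ f, i₁ ≫ f = f₁ ≫ m ∧ i₂ ≫ f = f₂ ≫ v := by
    have : s₁' ≫ f₁ ≫ m = t₂' ≫ f₂ ≫ v := by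
      rw [← reassoc_of% hg, hU.w, reassoc_of% hf₂.w]
    exact ⟨hU'.desc _ _ this, hU'.inl_desc .., hU'.inr_desc ..⟩
  have hi₁' : ∀ {x : Vertex} (e : Elem M' x), f.app _ (i₁.app _ e) = m.app _ (f₁.app _ e) :=
    fun e => app_eq hi₁ _ e
  have hi₂' : ∀ {x : Vertex} (e : Elem V' x), f.app _ (i₂.app _ e) = v.app _ (f₂.app _ e) :=
    fun e => app_eq hi₂ _ e
  -- In positive dimensions, each half of the composite restricts to the corresponding half.
  have hm : ∀ {x : Vertex}, 0 < x.dim → ∀ (e : Elem _ x) (q : Elem M x),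
      f.app _ e = m.app _ q → ∃ q', i₁.app _ q' = e := fun {x} hx e q he => by
    obtain h | ⟨b, rfl⟩ := exists_or_of_isPushout hU' _ e
    · exact h
    · rw [hi₂'] at he
      obtain ⟨z, -, hz⟩ := exists_of_isPushout_of_eq hU he.symm
      cases x with
      | star => exact (lt_irrefl _ hx).elim
      | agent k =>
        obtain ⟨z', rfl⟩ := hf₂.exists_initial b z hz.symm
        exact ⟨_, hi z'⟩
      | _ => exact (hs₁.isEmpty (by simp [Vertex.dim])).elim z
  have hv : ∀ {x : Vertex}, 0 < x.dim → ∀ (e : Elem _ x) (q : Elem V x),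
      f.app _ e = v.app _ q → ∃ q', i₂.app _ q' = e := fun {x} hx e q he => by
    obtain ⟨b, rfl⟩ | h := exists_or_of_isPushout hU' _ e
    · rw [hi₁'] at he
      obtain ⟨z, hz, -⟩ := exists_of_isPushout_of_eq hU he
      cases x with
      | star => exact (lt_irrefl _ hx).elim
      | agent k =>
        obtain ⟨z', rfl⟩ := hs₁'.exists_agent fun hb =>
          hs₁.not_consumed z (hz ▸ hb.map f₁)
        exact ⟨_, (hi z').symm⟩
      | _ => exact (hs₁.isEmpty (by simp [Vertex.dim])).elim z
    · exact h
  have hf : OneInjective f := by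
    intro ⟨x⟩ hx e e' he
    obtain ⟨q, rfl⟩ | ⟨q, rfl⟩ := exists_or_of_isPushout hU' _ e
    · obtain ⟨q', rfl⟩ := hm hx e' (f₁.app _ q) (he.symm.trans (hi₁' q))
      have := app_injective m _ ((hi₁' q).symm.trans (he.trans (hi₁' q')))
      rw [hf₁.oneInjective.injective hx this]
      rfl
    · obtain ⟨q', rfl⟩ := hv hx e' (f₂.app _ q) (he.symm.trans (hi₂' q))
      have := app_injective v _ ((hi₂' q).symm.trans (he.trans (hi₂' q')))
      rw [hf₂.oneInjective.injective hx this]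
      rfl
  refine ⟨Y', _, s₂' ≫ i₂, t₁' ≫ i₁, f, ⟨⟨hf₁.isTrace.trans hf₂.isTrace hU', ?_, hf, ?_⟩, ?_⟩⟩
  · rw [Category.assoc, hi₁, reassoc_of% hf₁.w]
  · intro k e p he
    obtain ⟨q, rfl⟩ := hm agent_dim_pos e _ he
    obtain ⟨q', rfl⟩ := hf₁.exists_initial q p (app_injective m _ ((hi₁' q).symm.trans he))
    exact ⟨q', rfl⟩
  · refine H_of_oneInjective hf fun {_ M₀ _ _ t₀} hS u a hua => ?_
    have hua' : ∀ {c} q, f.app c (u.app c q) = a.app c (t₀.app c q) := fun q => app_eq hua _ q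
    obtain ⟨x, hx, rfl⟩ := hS.exists_rep
    obtain ⟨w, rfl⟩ | ⟨w, rfl⟩ := rep_hom_factors hU a
    · obtain ⟨u, rfl⟩ := hS.exists_lift i₁ u fun k q => hm agent_dim_pos _ _ (hua' q)
      obtain ⟨b, ⟨-, hb⟩, -⟩ := hf₁.mem_H _ ⟨_, _, hS⟩ u w (by
        rw [← cancel_mono m, Category.assoc, ← hi₁, Category.assoc, ← hua, Category.assoc])
      exact ⟨b ≫ i₁, by rw [Category.assoc, hi₁, reassoc_of% hb]⟩
    · obtain ⟨u, rfl⟩ := hS.exists_lift i₂ u fun k q => hv agent_dim_pos _ _ (hua' q)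
      obtain ⟨b, ⟨-, hb⟩, -⟩ := hf₂.mem_H _ ⟨_, _, hS⟩ u w (by
        rw [← cancel_mono v, Category.assoc, ← hi₂, Category.assoc, ← hua, Category.assoc])
      exact ⟨b ≫ i₂, by rw [Category.assoc, hi₂, reassoc_of% hb]⟩

/-! ### Restrictions of actions -/

lemma edge_oneInjective {x y : Vertex} (e : Edge x y) (hx : 1 < x.dim) : OneInjective e.map := by
  intro ⟨z⟩ hz φ ψ h
  change 0 < Vertex.dim z at hz
  change φ ≫ e.hom = ψ ≫ e.hom at h
  cases e with
  | chan => simp [Vertex.dim] at hx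
  | t => simp [Vertex.dim] at hx
  | s => simp [Vertex.dim] at hx
  | _ =>
    have hφ := isNormal (x := z) φ
    have hψ := isNormal (x := z) ψ
    cases hφ <;> cases hψ <;> first
      | rfl
      | exact absurd hz (lt_irrefl _)
      | cases congrArg label h

lemma exists_t_of_eps {n : ℕ} {a : Fin n} {m : ℕ} {c d : Fin m} {x : Vertex} (hx : 0 < x.dim)
    (q : Elem (rep (.basic (.out m c d))) x) (h : ∃ p, (syncT n a m c d).app _ p =
      (Edge.eps n a m c d).map.app _ q) : ∃ p, (Edge.t (.out m c d)).map.app _ p = q := by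
  obtain ⟨p, hp⟩ := h
  cases isNormal q with
  | id => exact (isEmpty_glue (by simp [Vertex.dim])).elim p
  | t => exact ⟨𝟙 (Base.of _), Category.id_comp (Edge.t _).hom⟩
  | s =>
    have := ((IsSeed.sync n a m c d).consumed_iff _).2 ⟨p, hp⟩
    cases (consumed_rep_iff _).1 this
  | chan_s => exact absurd hx (lt_irrefl _)

lemma exists_t_of_rho {n : ℕ} {a : Fin n} {m : ℕ} {c d : Fin m} {x : Vertex} (hx : 0 < x.dim)
    (q : Elem (rep (.basic (.inp n a))) x) (h : ∃ p, (syncT n a m c d).app _ p =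
      (Edge.rho n a m c d).map.app _ q) : ∃ p, (Edge.t (.inp n a)).map.app _ p = q := by
  obtain ⟨p, hp⟩ := h
  cases isNormal q with
  | id => exact (isEmpty_glue (by simp [Vertex.dim])).elim p
  | t => exact ⟨𝟙 (Base.of _), Category.id_comp (Edge.t _).hom⟩
  | s =>
    have := ((IsSeed.sync n a m c d).consumed_iff _).2 ⟨p, hp⟩
    cases (consumed_rep_iff _).1 this
  | chan_s => exact absurd hx (lt_irrefl _)

lemma eps_ne_rho {n : ℕ} {a : Fin n} {m : ℕ} {c d : Fin m} {x : Vertex} (hx : 0 < x.dim)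
    (q : Elem (rep (.basic (.out m c d))) x) (q' : Elem (rep (.basic (.inp n a))) x) :
    (Edge.eps n a m c d).map.app _ q ≠ (Edge.rho n a m c d).map.app _ q' := by
  intro h
  have key : ∀ k, x = .agent k → False := by
    rintro k rfl
    have := congrArg label h
    erw [label_comp, label_comp] at this
    cases this
  cases isNormal q with
  | id =>
    clear h
    generalize hy : Vertex.basic (.out m c d) = y at q'
    cases isNormal q' with
    | id => cases hy
    | t => cases hy
    | s => cases hy
    | chan_s => cases hy
  | t => exact key _ rfl
  | s => exact key _ rfl
  | chan_s => exact absurd hx (lt_irrefl _)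

section

variable {X U X' Y' U' : Psh} {t : X ⟶ U} {h : X' ⟶ X} {s' : Y' ⟶ U'} {t' : X' ⟶ U'} {f : U' ⟶ U}

/-- The restriction of a trace to its initial position, regarded as an empty trace. -/
lemma isPartialRestriction_id [Mono t] (hX : IsPosition X') (hh : OneInjective h) :
    IsPartialRestriction t h (𝟙 X') (𝟙 X') (h ≫ t) where
  isTrace := .id _ _ hX inferInstance inferInstance
  w := Category.id_comp _
  oneInjective := hh.comp (.of_mono t)
  exists_initial e _ _ := ⟨e, rfl⟩

lemma IsPartialRestriction.exists_lift [Mono t] (hp : IsPartialRestriction t h s' t' f)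
    {Y₀ M₀ X₀ : Psh} {s₀ : Y₀ ⟶ M₀} {t₀ : X₀ ⟶ M₀} (hS : IsSeed s₀ t₀) (u : X₀ ⟶ U') (x : X₀ ⟶ X)
    (hu : u ≫ f = x ≫ t) : ∃ x' : X₀ ⟶ X', x' ≫ h = x := by
  have := hp.isTrace.mono
  obtain ⟨x', rfl⟩ := hS.exists_lift t' u fun k q => hp.exists_initial _ (x.app _ q) (app_eq hu _ q)
  exact ⟨x', by rw [← cancel_mono t, ← hu, Category.assoc, ← hp.w, Category.assoc]⟩

/-- A partial restriction may be extended by a seed that is not yet in its image, provided that its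
agents are available. -/
lemma IsPartialRestriction.exists_extension (hp : IsPartialRestriction t h s' t' f)
    {Y₀ M₀ X₀ : Psh} {s₀ : Y₀ ⟶ M₀} {t₀ : X₀ ⟶ M₀} (hS : IsSeed s₀ t₀) (u : X₀ ⟶ U') (e : M₀ ⟶ U)
    (hue : u ≫ f = t₀ ≫ e) (he : OneInjective e)
    (hc : ∀ k (q : Elem X₀ (.agent k)), ¬ Consumed U' (u.app _ q))
    (hf : ∀ {x : Vertex}, 0 < x.dim → ∀ (q : Elem M₀ x) (r : Elem U' x),
      e.app _ q = f.app _ r → ∃ p, t₀.app _ p = q)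
    (ht : ∀ {k : ℕ} (q : Elem M₀ (.agent k)) (p : Elem X (.agent k)),
      e.app _ q = t.app _ p → ∃ p, t₀.app _ p = q) :
    ∃ (Y'' U'' : Psh) (s'' : Y'' ⟶ U'') (k : U' ⟶ U'') (w : M₀ ⟶ U'') (f' : U'' ⟶ U),
      IsPartialRestriction t h s'' (t' ≫ k) f' ∧ k ≫ f' = f ∧ w ≫ f' = e ∧
        IsPushout t₀ u w k := by
  have := hS.mono_initial
  have hu : OneInjective u :=
    .of_comp (g := f) (hue ▸ (OneInjective.of_mono t₀).comp he)
  obtain ⟨Y'', U'', s'', w, k, hT, hU⟩ := hp.isTrace.exists_extension hS u hu hc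
  obtain ⟨f', hw, hk⟩ : ∃ f', w ≫ f' = e ∧ k ≫ f' = f :=
    ⟨hU.desc e f hue.symm, hU.inl_desc .., hU.inr_desc ..⟩
  have hw' : ∀ {c} q, f'.app c (w.app c q) = e.app c q := fun q => app_eq hw _ q
  have hk' : ∀ {c} q, f'.app c (k.app c q) = f.app c q := fun q => app_eq hk _ q
  have hwk : ∀ {c} q, w.app c (t₀.app c q) = k.app c (u.app c q) := fun q => app_eq hU.w _ q
  have hue' : ∀ {c} q, f.app c (u.app c q) = e.app c (t₀.app c q) := fun q => app_eq hue _ q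
  have key : ∀ {x : Vertex}, 0 < x.dim → ∀ (q : Elem M₀ x) (r : Elem U' x),
      e.app _ q = f.app _ r → w.app _ q = k.app _ r := fun hx q r hqr => by
    obtain ⟨p, rfl⟩ := hf hx q r hqr
    rw [hwk, hp.oneInjective.injective hx ((hue' p).trans hqr)]
  refine ⟨Y'', U'', s'', k, w, f', ⟨hT, ?_, fun ⟨x⟩ hx a b hab => ?_, fun {j} a p hap => ?_⟩, hk,
    hw, hU⟩
  · rw [Category.assoc, hk, hp.w]
  · change 0 < Vertex.dim x at hx
    obtain ⟨q, rfl⟩ | ⟨r, rfl⟩ := exists_or_of_isPushout hU _ a <;>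
    obtain ⟨q', rfl⟩ | ⟨r', rfl⟩ := exists_or_of_isPushout hU _ b
    · rw [he.injective hx ((hw' q).symm.trans (hab.trans (hw' q')))]
    · exact key hx q r' ((hw' q).symm.trans (hab.trans (hk' r')))
    · exact (key hx q' r ((hw' q').symm.trans (hab.symm.trans (hk' r)))).symm
    · rw [hp.oneInjective.injective hx ((hk' r).symm.trans (hab.trans (hk' r')))]
  · obtain ⟨r, rfl⟩ : ∃ r, k.app _ r = a := by
      obtain ⟨q, rfl⟩ | h := exists_or_of_isPushout hU _ a
      · obtain ⟨p', rfl⟩ := ht q p ((hw' q).symm.trans hap)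
        exact ⟨_, (hwk p').symm⟩
      · exact h
    obtain ⟨q, rfl⟩ := hp.exists_initial r p ((hk' r).symm.trans hap)
    exact ⟨q, rfl⟩

end

lemma IsGluing.mono {Y M X Y₀ M₀ X₀ : Psh} {s : Y ⟶ M} {t : X ⟶ M} {s₀ : Y₀ ⟶ M₀}
    {t₀ : X₀ ⟶ M₀} {x : X₀ ⟶ X} {m : M₀ ⟶ M} (h : IsGluing s t s₀ t₀ x m) : Mono t :=
  have := h.isSeed.mono_initial
  mono_of_isPushout h.isPushout

lemma IsGluing.oneInjective_map {Y M X Y₀ M₀ X₀ : Psh} {s : Y ⟶ M} {t : X ⟶ M} {s₀ : Y₀ ⟶ M₀}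
    {t₀ : X₀ ⟶ M₀} {x : X₀ ⟶ X} {m : M₀ ⟶ M} (h : IsGluing s t s₀ t₀ x m) : OneInjective m := by
  have := h.isSeed.mono_initial
  have := h.mono
  intro ⟨z⟩ hz q q' e
  obtain h' | ⟨a, ha⟩ := eq_or_exists_of_isPushout h.isPushout e
  · exact h'
  obtain h' | ⟨a', ha'⟩ := eq_or_exists_of_isPushout h.isPushout e.symm
  · exact h'.symm
  subst ha ha'
  have ht : t.app _ (x.app _ a) = t.app _ (x.app _ a') :=
    (app_eq h.isPushout.w _ a).symm.trans (e.trans (app_eq h.isPushout.w _ a'))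
  rw [h.oneInjective _ hz (app_injective t _ ht)]

lemma IsGluing.exists_map {Y M X Y₀ M₀ X₀ : Psh} {s : Y ⟶ M} {t : X ⟶ M} {s₀ : Y₀ ⟶ M₀}
    {t₀ : X₀ ⟶ M₀} {x : X₀ ⟶ X} {m : M₀ ⟶ M} (h : IsGluing s t s₀ t₀ x m) {z : Vertex}
    (hz : 1 < z.dim) (v : rep z ⟶ M) : ∃ a, a ≫ m = v := by
  obtain h' | ⟨a, -⟩ := rep_hom_factors h.isPushout v
  · exact h'
  · exact (h.isPosition.isEmpty hz).elim (a.app (op (Base.of z)) (𝟙 _))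

/-- When the initial position of the seed lifts, the whole seed does. -/
lemma IsGluing.exists_restriction_of_lift {Y M X Y₀ M₀ X₀ X' : Psh} {s : Y ⟶ M} {t : X ⟶ M}
    {s₀ : Y₀ ⟶ M₀} {t₀ : X₀ ⟶ M₀} {x : X₀ ⟶ X} {m : M₀ ⟶ M} (hg : IsGluing s t s₀ t₀ x m)
    (h : X' ⟶ X) (hX : IsPosition X') (hh : OneInjective h) (x' : X₀ ⟶ X') (hx' : x' ≫ h = x) :
    ∃ (Y' U' : Psh) (s' : Y' ⟶ U') (t' : X' ⟶ U') (f : U' ⟶ M), IsRestriction t h s' t' f := by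
  have := hg.mono
  have := hg.isSeed.mono_initial
  have hmt : ∀ {c : Vertex} (q : Elem M₀ c) (p : Elem X c), m.app _ q = t.app _ p →
      ∃ p, t₀.app _ p = q := fun q p e => by
    obtain ⟨a, ha, -⟩ := exists_of_isPushout_of_eq hg.isPushout e
    exact ⟨a, ha⟩
  obtain ⟨Y', U', s', k, w, f, hp, -, hw, -⟩ :=
    (isPartialRestriction_id (t := t) hX hh).exists_extension hg.isSeed x' m
      (by rw [reassoc_of% hx', hg.isPushout.w]) hg.oneInjective_map
      (fun k q => hX.not_consumed _) (fun _ q r e => hmt q (h.app _ r) e) hmt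
  refine ⟨Y', U', s', _, f, hp, H_of_oneInjective hp.oneInjective fun hS u v huv => ?_⟩
  obtain ⟨z, hz, rfl⟩ := hS.exists_rep
  obtain ⟨a, rfl⟩ := hg.exists_map hz v
  exact ⟨a ≫ w, by rw [Category.assoc, hw]⟩

/-- When the single agent of a seed does not lift, nothing does. The hypothesis `hfac` says that
this agent takes part in every action occurring in the seed. -/
lemma IsGluing.exists_restriction_of_not_lift {Y M X Y₀ M₀ X₀ X' : Psh} {s : Y ⟶ M} {t : X ⟶ M}
    {s₀ : Y₀ ⟶ M₀} {t₀ : X₀ ⟶ M₀} {x : X₀ ⟶ X} {m : M₀ ⟶ M} (hg : IsGluing s t s₀ t₀ x m)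
    (h : X' ⟶ X) (hX : IsPosition X') (hh : OneInjective h) (hx : ¬ ∃ x' : X₀ ⟶ X', x' ≫ h = x)
    (hfac : ∀ {Y₁ M₁ X₁ : Psh} {s₁ : Y₁ ⟶ M₁} {t₁ : X₁ ⟶ M₁}, IsSeed s₁ t₁ → ∀ e : M₁ ⟶ M₀,
      ∃ i : X₀ ⟶ X₁, i ≫ t₁ ≫ e = t₀) :
    ∃ (Y' U' : Psh) (s' : Y' ⟶ U') (t' : X' ⟶ U') (f : U' ⟶ M), IsRestriction t h s' t' f := by
  have := hg.mono
  have hp := isPartialRestriction_id (t := t) hX hh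
  refine ⟨_, _, _, _, _, hp, H_of_oneInjective hp.oneInjective fun hS u v huv => ?_⟩
  obtain ⟨z, hz, rfl⟩ := hS.exists_rep
  obtain ⟨a, rfl⟩ := hg.exists_map hz v
  obtain ⟨i, hi⟩ := hfac hS a
  exact (hx (hp.exists_lift hg.isSeed (i ≫ u) x (by
    rw [Category.assoc, huv, reassoc_of% hi, hg.isPushout.w]))).elim

section Sync

variable {n m : ℕ} {a : Fin n} {c d : Fin m} {Y M X X' : Psh} {s : Y ⟶ M} {t : X ⟶ M}
  {x : syncInitial n a m c ⟶ X} {μ : rep (.sync n a m c d) ⟶ M} {h : X' ⟶ X}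

lemma IsGluing.sender (hg : IsGluing s t (syncS n a m c d) (syncT n a m c d) x μ) :
    (Edge.t (.out m c d)).map ≫ (Edge.eps n a m c d).map ≫ μ = (glueInl _ _ ≫ x) ≫ t := by
  rw [Category.assoc, ← hg.isPushout.w, syncT, ← Category.assoc (glueInl _ _), glueInl_glueDesc,
    Category.assoc]

lemma IsGluing.receiver (hg : IsGluing s t (syncS n a m c d) (syncT n a m c d) x μ) :
    (Edge.t (.inp n a)).map ≫ (Edge.rho n a m c d).map ≫ μ = (glueInr _ _ ≫ x) ≫ t := by
  rw [Category.assoc, ← hg.isPushout.w, syncT, ← Category.assoc (glueInr _ _), glueInr_glueDesc,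
    Category.assoc]

/-- The output of a synchronisation is restored whenever the sender lifts. -/
lemma IsGluing.exists_restriction_sender
    (hg : IsGluing s t (syncS n a m c d) (syncT n a m c d) x μ) (hX : IsPosition X')
    (hh : OneInjective h) :
    ∃ (Y' U' : Psh) (s' : Y' ⟶ U') (t' : X' ⟶ U') (f : U' ⟶ M), IsPartialRestriction t h s' t' f ∧
      ((∃ x' : rep (.agent m) ⟶ X', x' ≫ h = glueInl _ _ ≫ x) →
        ∃ w, w ≫ f = (Edge.eps n a m c d).map ≫ μ) ∧
      ∀ {z : Vertex} (r : Elem U' z), (∃ p, f.app _ r = t.app _ p) ∨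
        ∃ q, f.app _ r = ((Edge.eps n a m c d).map ≫ μ).app _ q := by
  have := hg.mono
  have := hg.isSeed.mono_initial
  have hp := isPartialRestriction_id (t := t) hX hh
  by_cases hx : ∃ x' : rep (.agent m) ⟶ X', x' ≫ h = glueInl _ _ ≫ x
  · obtain ⟨x', hx'⟩ := hx
    have hmt : ∀ {z : Vertex}, 0 < z.dim → ∀ (q : Elem (rep (.basic (.out m c d))) z)
        (p : Elem X z), ((Edge.eps n a m c d).map ≫ μ).app _ q = t.app _ p →
        ∃ p, (Edge.t (.out m c d)).map.app _ p = q := fun hz q p e => by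
      obtain ⟨b, hb, -⟩ := exists_of_isPushout_of_eq hg.isPushout
        (b := (Edge.eps n a m c d).map.app _ q) e
      exact exists_t_of_eps hz q ⟨b, hb⟩
    obtain ⟨Y', U', s', k, w, f, hp', hk, hw, hU⟩ :=
      hp.exists_extension (.basic (.out m c d)) x' _
        (by rw [reassoc_of% hx', hg.sender, Category.assoc])
        ((edge_oneInjective (Edge.eps n a m c d) (by simp [Vertex.dim])).comp hg.oneInjective_map)
        (fun k q => hX.not_consumed _) (fun hz q r e => hmt hz q (h.app _ r) e)
        (hmt agent_dim_pos)
    refine ⟨Y', U', s', _, f, hp', fun _ => ⟨w, hw⟩, fun r => ?_⟩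
    obtain ⟨q, rfl⟩ | ⟨q, rfl⟩ := exists_or_of_isPushout hU _ r
    · exact .inr ⟨q, app_eq hw _ q⟩
    · exact .inl ⟨h.app _ q, app_eq hk _ q⟩
  · exact ⟨_, _, _, _, _, hp, fun h => (hx h).elim, fun r => .inl ⟨h.app _ r, rfl⟩⟩

/-- The output and the input of a synchronisation are independently restored whenever the sender
or the receiver lifts. -/
lemma IsGluing.exists_restriction_both
    (hg : IsGluing s t (syncS n a m c d) (syncT n a m c d) x μ) (hX : IsPosition X')
    (hh : OneInjective h) :
    ∃ (Y' U' : Psh) (s' : Y' ⟶ U') (t' : X' ⟶ U') (f : U' ⟶ M), IsPartialRestriction t h s' t' f ∧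
      ((∃ x' : rep (.agent m) ⟶ X', x' ≫ h = glueInl _ _ ≫ x) →
        ∃ w, w ≫ f = (Edge.eps n a m c d).map ≫ μ) ∧
      ((∃ x' : rep (.agent n) ⟶ X', x' ≫ h = glueInr _ _ ≫ x) →
        ∃ w, w ≫ f = (Edge.rho n a m c d).map ≫ μ) := by
  have := hg.mono
  have := hg.isSeed.mono_initial
  obtain ⟨Y₁, U₁, s₁, t₁, f₁, hp, hε, hr⟩ := hg.exists_restriction_sender hX hh
  by_cases hx : ∃ x' : rep (.agent n) ⟶ X', x' ≫ h = glueInr _ _ ≫ x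
  · obtain ⟨x', hx'⟩ := hx
    have hmt : ∀ {z : Vertex}, 0 < z.dim → ∀ (q : Elem (rep (.basic (.inp n a))) z)
        (p : Elem X z), ((Edge.rho n a m c d).map ≫ μ).app _ q = t.app _ p →
        ∃ p, (Edge.t (.inp n a)).map.app _ p = q := fun hz q p e => by
      obtain ⟨b, hb, -⟩ := exists_of_isPushout_of_eq hg.isPushout
        (b := (Edge.rho n a m c d).map.app _ q) e
      exact exists_t_of_rho hz q ⟨b, hb⟩
    have hne : ∀ {z : Vertex}, 0 < z.dim → ∀ (q : Elem (rep (.basic (.out m c d))) z)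
        (q' : Elem (rep (.basic (.inp n a))) z), ((Edge.eps n a m c d).map ≫ μ).app _ q ≠
          ((Edge.rho n a m c d).map ≫ μ).app _ q' := fun hz q q' e =>
      eps_ne_rho hz q q' (hg.oneInjective_map.injective hz e)
    have hu : (x' ≫ t₁) ≫ f₁ = (Edge.t (.inp n a)).map ≫ (Edge.rho n a m c d).map ≫ μ := by
      rw [Category.assoc, hp.w, reassoc_of% hx', hg.receiver, Category.assoc]
    obtain ⟨Y', U', s', k, w, f, hp', hk, hw, hU⟩ :=
      hp.exists_extension (.basic (.inp n a)) (x' ≫ t₁) _ hu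
        ((edge_oneInjective (Edge.rho n a m c d) (by simp [Vertex.dim])).comp hg.oneInjective_map)
        (by
          rintro k q ⟨k', v, b, hb⟩
          obtain ⟨p, -⟩ | ⟨q', hq'⟩ := hr b
          · exact (hg.isPosition.isEmpty (x := .basic v) (by simp [Vertex.dim])).elim p
          · refine hne agent_dim_pos ((rep _).map (Edge.t v).hom.op q')
              ((Edge.t (.inp n a)).map.app _ q) ?_
            rw [app_map, ← hq', ← app_map, hb]
            exact app_eq hu _ q)
        (fun hz q r e => by
          obtain ⟨p, hp⟩ | ⟨q', hq'⟩ := hr r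
          · exact hmt hz q p (e.trans hp)
          · exact (hne hz q' q (hq'.symm.trans e.symm)).elim)
        (hmt agent_dim_pos)
    refine ⟨Y', U', s', _, f, hp', fun hx => ?_, fun _ => ⟨w, hw⟩⟩
    obtain ⟨w', hw'⟩ := hε hx
    exact ⟨w' ≫ k, by rw [Category.assoc, hk, hw']⟩
  · exact ⟨_, _, _, _, _, hp, hε, fun h => (hx h).elim⟩

/-- When the sender and the receiver do not lift to agents sharing a channel, there is nothing in
the restriction but an output and an input. -/
lemma IsGluing.exists_restriction_sync_of_not_lift
    (hg : IsGluing s t (syncS n a m c d) (syncT n a m c d) x μ) (hX : IsPosition X')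
    (hh : OneInjective h) (hx : ¬ ∃ x' : syncInitial n a m c ⟶ X', x' ≫ h = x) :
    ∃ (Y' U' : Psh) (s' : Y' ⟶ U') (t' : X' ⟶ U') (f : U' ⟶ M), IsRestriction t h s' t' f := by
  have := hg.mono
  obtain ⟨Y', U', s', t', f, hp, hε, hρ⟩ := hg.exists_restriction_both hX hh
  refine ⟨Y', U', s', t', f, hp, H_of_oneInjective hp.oneInjective fun hS u v huv => ?_⟩
  obtain ⟨z, hz, hz'⟩ := hS.exists_rep
  obtain ⟨e, rfl⟩ : ∃ e, e ≫ μ = v := by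
    subst hz'
    exact hg.exists_map hz v
  cases hS with
  | basic b =>
    obtain ⟨φ, rfl⟩ := yoneda.map_surjective e
    cases isNormal φ with
    | eps => exact hε (hp.exists_lift (.basic (.out m c d)) u _ (huv.trans hg.sender))
    | rho => exact hρ (hp.exists_lift (.basic (.inp n a)) u _ (huv.trans hg.receiver))
  | fork k =>
    obtain ⟨φ, rfl⟩ := yoneda.map_surjective e
    cases isNormal φ
  | sync n' a' m' c' d' =>
    obtain ⟨φ, rfl⟩ := yoneda.map_surjective e
    cases isNormal φ
    refine (hx (hp.exists_lift hg.isSeed u x ?_)).elim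
    rw [huv, ← hg.isPushout.w]
    simp

end Sync

lemma IsGluing.hasRestrictions {Y M X Y₀ M₀ X₀ : Psh} {s : Y ⟶ M} {t : X ⟶ M} {s₀ : Y₀ ⟶ M₀}
    {t₀ : X₀ ⟶ M₀} {x : X₀ ⟶ X} {m : M₀ ⟶ M} (hg : IsGluing s t s₀ t₀ x m) :
    HasRestrictions t := by
  intro X' h hX hh
  by_cases hx : ∃ x' : X₀ ⟶ X', x' ≫ h = x
  · obtain ⟨x', hx'⟩ := hx
    exact hg.exists_restriction_of_lift h hX hh x' hx'
  · cases hg.isSeed with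
    | basic v =>
      exact hg.exists_restriction_of_not_lift h hX hh hx fun hS e => hS.exists_factor_basic v e
    | fork n =>
      exact hg.exists_restriction_of_not_lift h hX hh hx fun hS e => hS.exists_factor_fork e
    | sync n a k c d => exact hg.exists_restriction_sync_of_not_lift hX hh hx

lemma IsTrace.hasRestrictions {Y U X : Psh} {s : Y ⟶ U} {t : X ⟶ U} (h : IsTrace s t) :
    HasRestrictions t := by
  induction h with
  | id s t hX hs ht =>
    intro X' h hX' hh
    have hp := isPartialRestriction_id (t := t) hX' hh
    refine ⟨_, _, _, _, _, hp, H_of_oneInjective hp.oneInjective fun hS u v _ => ?_⟩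
    exact ((hS.isEmpty_hom fun x hx => (hX.of_isIso (inv t)).isEmpty hx).false v).elim
  | comp s₁ t₁ s₂ t₂ m v hM hV hU ih =>
    obtain ⟨_, _, _, _, _, _, _, hg⟩ := hM.exists_isGluing
    exact .comp (.of_action hM) hV hU hg.hasRestrictions ih

/-! ### Cartesian double cells -/

/-- Double cells into a trace with a middle component in `H` are cartesian: the filler for the tips
exists by orthogonality, and it restricts to final positions because maps of presheaves preserve
consumed agents. -/
lemma isStronglyCartesian_of_mem_H {W U : D1H} (r : W ⟶ U) (hW : IsFinalLeg W.vert.s)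
    (hU : IsFinalLeg U.vert.s) (hr : H r.mid) : cod1.IsStronglyCartesian (cod1.map r) r where
  universal_property' {T} g φ hφ := by
    let g' : T.vert.initial.psh ⟶ W.vert.initial.psh := g
    have hbot : g' ≫ r.bot = φ.bot := IsHomLift.eq_of_isHomLift cod1 (g ≫ cod1.map r) φ
    have := hW.mono
    have := hU.mono
    obtain ⟨q, ⟨hq, hq'⟩, hq''⟩ := T.mem_V r.mid hr (g' ≫ W.vert.t) φ.mid (by
      rw [Category.assoc, ← r.comm_t, ← Category.assoc, hbot, φ.comm_t])
    have hs : ∀ {c} (e : T.vert.final.psh.obj c),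
        r.mid.app c (q.app c (T.vert.s.app c e)) = U.vert.s.app c (φ.top.app c e) := fun e =>
      (app_eq hq' _ _).trans (app_eq φ.comm_s _ e).symm
    obtain ⟨p, hp⟩ := exists_lift W.vert.s (T.vert.s ≫ q) fun x e => by
      cases x with
      | star => exact hW.exists_star _
      | agent k =>
        exact hW.exists_agent fun he => hU.not_consumed _ ((hs e) ▸ he.map r.mid)
      | _ => exact (hU.isEmpty (by simp [Vertex.dim])).elim (φ.top.app _ e)
    let χ : T ⟶ W := ⟨p, q, g', hp, hq.symm⟩
    have hχ : cod1.IsHomLift g χ := IsHomLift.map cod1 χ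
    refine ⟨χ, ⟨hχ, Cell.ext ?_ hq' hbot⟩, ?_⟩
    · rw [← cancel_mono U.vert.s]
      change (p ≫ r.top) ≫ U.vert.s = φ.top ≫ U.vert.s
      rw [Category.assoc, r.comm_s, reassoc_of% hp, hq', φ.comm_s]
    · rintro χ ⟨hχ, rfl⟩
      have hχg : g' = χ.bot := IsHomLift.eq_of_isHomLift cod1 g χ
      have hmid : χ.mid = q := hq'' χ.mid ⟨by rw [hχg]; exact χ.comm_t.symm, rfl⟩
      refine Cell.ext ?_ hmid hχg.symm
      rw [← cancel_mono W.vert.s, hp, χ.comm_s, hmid]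

/-- Cartesianness is inherited by `𝔻_H`, because the first factor of a `1`-injective composite is
`1`-injective. -/
lemma isStronglyCartesian_cod {W U : DH} (r : W ⟶ U)
    (hr : cod1.IsStronglyCartesian (cod1.map (inclH.map r)) (inclH.map r)) :
    cod.IsStronglyCartesian (cod.map r) r where
  universal_property' {T} g φ hφ := by
    have hbot : g ≫ cod.map r = cod.map φ := IsHomLift.eq_of_isHomLift cod (g ≫ cod.map r) φ
    have hbot' : cod1.map (inclH.map φ) = inclh.map g ≫ cod1.map (inclH.map r) :=
      (congrArg Subtype.val hbot).symm
    have := IsHomLift.map cod1 (inclH.map φ)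
    obtain ⟨χ, ⟨hχ, hχ'⟩, hu⟩ := @Functor.IsStronglyCartesian.universal_property _ _ _ _
      cod1 _ _ _ _ (cod1.map (inclH.map r)) (inclH.map r) hr _ (inclH.obj T) (inclh.map g)
      (cod1.map (inclH.map φ)) hbot' (inclH.map φ) this
    have hχg : g.1 = χ.bot :=
      @IsHomLift.eq_of_isHomLift _ _ _ _ cod1 (inclH.obj T) (inclH.obj W) (inclh.map g) χ hχ
    have htop : χ.top ≫ r.1.top = φ.1.top := congrArg Cell.top hχ'
    have hmid : χ.mid ≫ r.1.mid = φ.1.mid := congrArg Cell.mid hχ'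
    have hinj : χ.OneInj :=
      ⟨.of_comp (g := r.1.top) (htop ▸ φ.2.1), .of_comp (g := r.1.mid) (hmid ▸ φ.2.2.1),
        hχg ▸ g.2⟩
    refine ⟨⟨χ, hinj⟩, ⟨?_, Subtype.ext hχ'⟩, ?_⟩
    · have : g = cod.map (X := T) (Y := W) ⟨χ, hinj⟩ := Subtype.ext hχg
      rw [this]
      infer_instance
    · rintro ψ ⟨hψ, rfl⟩
      have hψg : g = cod.map ψ := IsHomLift.eq_of_isHomLift cod g ψ
      refine Subtype.ext (hu (inclH.map ψ) ⟨?_, rfl⟩)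
      rw [hψg]
      exact IsHomLift.map cod1 (inclH.map ψ)

lemma exists_cartesian_lift (U : DH) (X' : Dh) (h : X' ⟶ cod.obj U) :
    ∃ (U' : DH) (r : U' ⟶ U), cod.IsStronglyCartesian h r ∧
      cod1.IsStronglyCartesian (inclh.map h) (inclH.map r) := by
  obtain ⟨X'⟩ := X'
  obtain ⟨Y', U', s', t', f, hp, hf⟩ := U.isTrace.hasRestrictions h.1 X'.isPosition h.2
  have hs := U.isTrace.isFinalLeg
  have hs' := hp.isTrace.isFinalLeg
  have := hs'.mono
  obtain ⟨g, hg⟩ := hs.exists_map hs' hf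
  let W : DH := ⟨⟨⟨Y', hp.isTrace.isPosition_final⟩, U', X', s', t'⟩, hp.isTrace⟩
  let r : W ⟶ U := ⟨⟨g, f, h.1, hg, hp.w.symm⟩,
    .of_comp (g := U.vert.s) (hg ▸ (OneInjective.of_mono s').comp hp.oneInjective),
    hp.oneInjective, h.2⟩
  have h₁ := isStronglyCartesian_of_mem_H (inclH.map r) hs' hs hf
  exact ⟨W, r, isStronglyCartesian_cod r h₁, h₁⟩

lemma isIso_cell {W U : D1H} (e : W ≅ U) : IsIso e.hom.top ∧ IsIso e.hom.mid ∧ IsIso e.hom.bot :=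
  ⟨⟨e.inv.top, congrArg Cell.top e.hom_inv_id, congrArg Cell.top e.inv_hom_id⟩,
    ⟨e.inv.mid, congrArg Cell.mid e.hom_inv_id, congrArg Cell.mid e.inv_hom_id⟩,
    ⟨e.inv.bot, congrArg Cell.bot e.hom_inv_id, congrArg Cell.bot e.inv_hom_id⟩⟩

lemma Cell.oneInj_of_isIso {W U : VerticalMorphism} (α : Cell W U)
    (h : IsIso α.top ∧ IsIso α.mid ∧ IsIso α.bot) : α.OneInj := by
  obtain ⟨h₁, h₂, h₃⟩ := h
  exact ⟨.of_mono _, .of_mono _, .of_mono _⟩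

lemma Cell.isTrace_of_isIso {W U : VerticalMorphism} (α : Cell W U)
    (h : IsIso α.top ∧ IsIso α.mid ∧ IsIso α.bot) (hU : IsTrace U.s U.t) : IsTrace W.s W.t := by
  obtain ⟨h₁, h₂, h₃⟩ := h
  have hs : W.s = α.top ≫ U.s ≫ inv α.mid := by
    rw [← Category.assoc, IsIso.eq_comp_inv, α.comm_s]
  have ht : W.t = α.bot ≫ U.t ≫ inv α.mid := by
    rw [← Category.assoc, IsIso.eq_comp_inv, α.comm_t]
  rw [hs, ht]
  exact hU.iso _ _ _

lemma isStronglyCartesian_map {𝒳 𝒮 : Type*} [Category* 𝒳] [Category* 𝒮] (p : 𝒳 ⥤ 𝒮) {R S : 𝒮}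
    (f : R ⟶ S) {a b : 𝒳} (φ : a ⟶ b) (hφ : p.IsStronglyCartesian f φ) :
    p.IsStronglyCartesian (p.map φ) φ := by
  subst_hom_lift p f φ
  assumption

/-- Cartesian liftings in `𝔻¹_H` of `1`-injective maps at traces lie in `𝔻_H`, being isomorphic to
those of `𝔻_H`. -/
lemma exists_of_isStronglyCartesian (U : DH) (X' : Dh) (h : X' ⟶ cod.obj U) (W : D1H)
    (r : W ⟶ inclH.obj U) (hr : cod1.IsStronglyCartesian (inclh.map h) r) :
    ∃ (U' : DH) (hU' : inclH.obj U' = W) (r' : U' ⟶ U),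
      inclH.map r' = eqToHom hU' ≫ r ∧ cod.IsStronglyCartesian h r' := by
  obtain ⟨V, ρ, -, hρ⟩ := exists_cartesian_lift U X' h
  let e : W ≅ inclH.obj V := Functor.IsCartesian.domainUniqueUpToIso cod1 (inclh.map h)
    (inclH.map ρ) r
  have he : e.hom ≫ inclH.map ρ = r := Functor.IsCartesian.fac cod1 (inclh.map h) (inclH.map ρ) r
  have hinj : Cell.OneInj r := by
    have he' : Cell.OneInj e.hom := Cell.oneInj_of_isIso e.hom (isIso_cell e)
    rw [← he]
    exact ⟨he'.1.comp ρ.2.1, he'.2.1.comp ρ.2.2.1, he'.2.2.comp ρ.2.2.2⟩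
  obtain ⟨X'⟩ := X'
  have hX : W.vert.initial = X' :=
    @IsHomLift.domain_eq _ _ _ _ cod1 _ _ _ _ (inclh.map h) r hr.toIsHomLift
  subst hX
  have hh : h.1 = r.bot :=
    @IsHomLift.eq_of_isHomLift _ _ _ _ cod1 W (inclH.obj U) (inclh.map h) r hr.toIsHomLift
  let W' : DH := ⟨W.vert, Cell.isTrace_of_isIso (U := V.vert) e.hom (isIso_cell e) V.isTrace⟩
  let r' : W' ⟶ U := ⟨r, hinj⟩
  have hh' : h = cod.map r' := Subtype.ext hh
  refine ⟨W', rfl, r', (Category.id_comp _).symm, ?_⟩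
  rw [hh']
  exact isStronglyCartesian_cod r' (isStronglyCartesian_map cod1 (inclh.map h) r hr)

end PiTraces

end
open PiTraces in
theorem mainTheorem4 :
    IsSubfibration cod cod1 inclH inclh ∧
    ∀ (U : DH) (X' : Dh) (h : X' ⟶ cod.obj U),
      (∃ (U' : DH) (r : U' ⟶ U), cod.IsStronglyCartesian h r ∧
        cod1.IsStronglyCartesian (inclh.map h) (inclH.map r)) ∧
      ∀ (W : D1H) (r : W ⟶ inclH.obj U), cod1.IsStronglyCartesian (inclh.map h) r →
        ∃ (U' : DH) (hU' : inclH.obj U' = W) (r' : U' ⟶ U),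
          inclH.map r' = eqToHom hU' ≫ r ∧ cod.IsStronglyCartesian h r' := by
  refine ⟨⟨⟨?_, ⟨fun h => Subtype.ext h⟩⟩, ⟨?_, ⟨fun h => Subtype.ext h⟩⟩, rfl, ?_, ?_⟩,
    fun U X' h => ⟨exists_cartesian_lift U X' h, exists_of_isStronglyCartesian U X' h⟩⟩
  · rintro ⟨U, hU⟩ ⟨W, hW⟩ h
    cases h
    rfl
  · rintro ⟨X⟩ ⟨Y⟩ h
    cases h
    rfl
  · refine .of_exists_isStronglyCartesian fun U X' h => ?_
    obtain ⟨U', r, hr, -⟩ := exists_cartesian_lift U X' h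
    exact ⟨U', r, hr⟩
  · intro V U r hr
    -- Any two cartesian liftings differ by an isomorphism over the identity.
    obtain ⟨W, ρ, hρ, hρ'⟩ := exists_cartesian_lift U _ (cod.map r)
    let e : V ≅ W := Functor.IsCartesian.domainUniqueUpToIso cod (cod.map r) ρ r
    have he : e.hom ≫ ρ = r := Functor.IsCartesian.fac cod (cod.map r) ρ r
    rw [← he, inclH.map_comp, cod1.map_comp]
    have := isStronglyCartesian_map cod1 _ _ hρ'
    infer_instance
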